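/- **Theorem (Consistency).** Let $n\ge 1$, $s>0$, and let $b\in C^1([0,\infty))$ be increasing with $b\ge b_0$ and $b'\ge b_0'$ on $[0,\infty)$ for some constants $b_0,b_0'>0$. Let $(u_0,u_1)\in H^s(\mathbb R^n)\times H^{s-1}(\mathbb R^n)$ and consider the Cauchy problem $$\partial_t^2u-\Delta u+\frac{b'(t)}{b(t)}\,\partial_tu=0\ \text{ in }[0,\infty)\times\mathbb R^n,\qquad u(0)=u_0,\quad \partial_tu(0)=u_1. \tag{1}$$ *Regularising families.* A regularising family of $b$ is a net $(b_\varepsilon)_{\varepsilon\in(0,1]}$ of the form $b_\varepsilon=\tilde b*\psi_{\omega(\varepsilon)}$, $\psi_\omega(t)=\omega^{-1}\psi(t/\omega)$, where $\psi\in C_0^\infty(\mathbb R)$, $\psi\ge0$, $\int\psi=1$, $\omega(\varepsilon)>0$ and $\omega(\varepsilon)\to0$ as $\varepsilon\to0$, and $\tilde b$ is any positive, locally Lipschitz extension of $b$ to $\mathbb R$, such that $(b_\varepsilon)$ is $C^\infty$-moderate: for every compact $K\subset\mathbb R$ and every $k\in\mathbb N_0$ there are $N\in\mathbb N_0$ and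 $c>0$ with $\sup_{t\in K}|\partial^kb_\varepsilon(t)|\le c\,\varepsilon^{-N-k}$ for all $\varepsilon\in(0,1]$. *Very weak solutions.* A net $(u_\varepsilon)_{\varepsilon\in(0,1]}$ is a very weak solution of order $s$ of (1), with the regularising family $(b_\varepsilon)$, if $u_\varepsilon\in C^k([0,\infty);H^{s-k})$ for all $k\in\mathbb N_0$, if for every $\varepsilon\in(0,1]$ the function $u_\varepsilon$ solves (1) with $b'/b$ replaced by $b_\varepsilon'/b_\varepsilon$ (and the same data), and if the net is $C^\infty([0,\infty);H^s)$-moderate: there is $N\in\mathbb N_0$ and for every $k\in\mathbb N_0$ there is $c_k>0$ such that $\|\partial_t^ku_\varepsilon(t)\|_{H^{s-k}}\le c_k\,\varepsilon^{-N-k}$ for all $t\ge0$ and $\varepsilon\in(0,1]$. Then (1) has a solution $u\in C([0,\infty);H^s)\cap C^1([0,\infty);H^{s-1})$ which, for every $T>0$, is on $[0,T]$ the unique solution of (1) in $C([0,T];H^s)\cap C^1([0,T];H^{s-1})$ (the equation being understood in the sense of distributions). For every regularising family $(b_\varepsilon)$ of $b$, every very weak solution $(u_\varepsilon)$ of order $s$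 of (1) with this family, and every $T>0$, $$u_\varepsilon\to u\quad\text{in } C([0,T];H^s)\cap C^1([0,T];H^{s-1})\quad\text{as }\varepsilon\to0 .$$ -/

import Mathlib

open MeasureTheory Set Filter Topology
open scoped SchwartzMap Laplacian ContDiff Convolution

noncomputable section

namespace DampedWave

/-- The tempered distributions on `ℝⁿ` that belong to the (Bessel potential) Sobolev space
`H^s = H^{s,2}`, as a subspace of all tempered distributions. -/
def sobolevSubmodule (n : ℕ) (s : ℝ) : Submodule ℂ 𝓢'(EuclideanSpace ℝ (Fin n), ℂ) where
  carrier := {f | TemperedDistribution.MemSobolev s 2 f}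
  add_mem' hf hg := hf.add hg
  zero_mem' := TemperedDistribution.memSobolev_fun_zero _ _ _ _
  smul_mem' c _ hf := hf.smul c

/-- The Sobolev space `H^s(ℝⁿ)`, `s ∈ ℝ`. -/
def Sobolev (n : ℕ) (s : ℝ) : Type := sobolevSubmodule n s

namespace Sobolev

variable {n : ℕ} {s : ℝ}

instance : AddCommGroup (Sobolev n s) := inferInstanceAs (AddCommGroup (sobolevSubmodule n s))

instance : Module ℂ (Sobolev n s) := inferInstanceAs (Module ℂ (sobolevSubmodule n s))

/-- The inclusion of `H^s(ℝⁿ)` into the tempered distributions. -/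
def toDist : Sobolev n s →ₗ[ℂ] 𝓢'(EuclideanSpace ℝ (Fin n), ℂ) := (sobolevSubmodule n s).subtype

theorem toDist_injective : Function.Injective (toDist (n := n) (s := s)) :=
  Subtype.val_injective

theorem memSobolev (f : Sobolev n s) : TemperedDistribution.MemSobolev s 2 (toDist f) := f.2

/-- An element of `H^s(ℝⁿ)`, from a tempered distribution. -/
def mk (f : 𝓢'(EuclideanSpace ℝ (Fin n), ℂ)) (hf : TemperedDistribution.MemSobolev s 2 f) :
    Sobolev n s := ⟨f, hf⟩

@[simp] theorem toDist_mk (f : 𝓢'(EuclideanSpace ℝ (Fin n), ℂ))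
    (hf : TemperedDistribution.MemSobolev s 2 f) : toDist (mk f hf) = f := rfl

theorem lp_ext {f g : Lp ℂ 2 (volume : Measure (EuclideanSpace ℝ (Fin n)))}
    (h : (f : 𝓢'(EuclideanSpace ℝ (Fin n), ℂ)) = g) : f = g :=
  LinearMap.ker_eq_bot.mp (Lp.ker_toTemperedDistributionCLM_eq_bot (F := ℂ)
    (μ := (volume : Measure (EuclideanSpace ℝ (Fin n)))) (p := 2)) h

/-- The function in `L²(ℝⁿ)` that represents `⟨D⟩^s f`, for `f ∈ H^s(ℝⁿ)`. -/
def besselFun (f : Sobolev n s) : Lp ℂ 2 (volume : Measure (EuclideanSpace ℝ (Fin n))) :=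
  Exists.choose (memSobolev f)

theorem besselFun_spec (f : Sobolev n s) :
    TemperedDistribution.besselPotential _ ℂ s (toDist f) =
      Lp.toTemperedDistributionCLM ℂ volume 2 (besselFun f) :=
  Exists.choose_spec (memSobolev f)

/-- The linear map `f ↦ ⟨D⟩^s f` from `H^s(ℝⁿ)` to `L²(ℝⁿ)`. -/
def bessel : Sobolev n s →ₗ[ℂ] Lp ℂ 2 (volume : Measure (EuclideanSpace ℝ (Fin n))) where
  toFun := besselFun
  map_add' f g := lp_ext <| by
    rw [← Lp.toTemperedDistributionCLM_apply, ← Lp.toTemperedDistributionCLM_apply, map_add,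
      ← besselFun_spec, ← besselFun_spec, ← besselFun_spec, map_add, map_add]
  map_smul' c f := lp_ext <| by
    rw [← Lp.toTemperedDistributionCLM_apply, ← Lp.toTemperedDistributionCLM_apply, map_smul,
      ← besselFun_spec, ← besselFun_spec, map_smul, map_smul, RingHom.id_apply]

theorem bessel_spec (f : Sobolev n s) :
    TemperedDistribution.besselPotential _ ℂ s (toDist f) = (bessel f : 𝓢'(_, ℂ)) :=
  besselFun_spec f

theorem bessel_injective : Function.Injective (bessel (n := n) (s := s)) := by
  intro f g h
  apply toDist_injective
  have h1 := (TemperedDistribution.besselPotential_neg_apply_eq_iff s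
    (bessel f : 𝓢'(EuclideanSpace ℝ (Fin n), ℂ)) (toDist f)).2 (bessel_spec f)
  have h2 := (TemperedDistribution.besselPotential_neg_apply_eq_iff s
    (bessel g : 𝓢'(EuclideanSpace ℝ (Fin n), ℂ)) (toDist g)).2 (bessel_spec g)
  rw [← h1, ← h2, h]

/-- The norm of `H^s(ℝⁿ)` is `‖f‖_{H^s} = ‖⟨D⟩^s f‖_{L²}`. -/
instance : NormedAddCommGroup (Sobolev n s) :=
  NormedAddCommGroup.induced (Sobolev n s) _ bessel bessel_injective

instance : NormedSpace ℂ (Sobolev n s) := NormedSpace.induced ℂ (Sobolev n s) _ bessel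

theorem norm_eq (f : Sobolev n s) : ‖f‖ = ‖bessel f‖ := rfl

/-- The inclusion `H^s(ℝⁿ) ⊂ H^{s-k}(ℝⁿ)`, `k ∈ ℕ`. -/
def lower (k : ℕ) (f : Sobolev n s) : Sobolev n (s - k) :=
  mk (toDist f) ((memSobolev f).mono (by simp))

end Sobolev

variable {n : ℕ} {s : ℝ}

/-- `u ∈ C^k(I; H^{s-k})`, for a function `u` of time with values in `H^s`. -/
def IsCk (k : ℕ) (I : Set ℝ) (u : ℝ → Sobolev n s) : Prop :=
  ContDiffOn ℝ k (fun t ↦ (u t).lower k) I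

/-- The time derivative `∂_t^k u(t) ∈ H^{s-k}`, `t ∈ I`, of `u ∈ C^k(I; H^{s-k})`. -/
def timeDeriv (k : ℕ) (I : Set ℝ) (u : ℝ → Sobolev n s) (t : ℝ) : Sobolev n (s - k) :=
  iteratedDerivWithin k (fun τ ↦ (u τ).lower k) I t

/-- `u` is a solution in `C(I; H^s) ∩ C¹(I; H^{s-1})` of the Cauchy problem
`∂_t² u - Δ u + a(t) ∂_t u = 0` in `I × ℝⁿ`, `u(0) = u₀`, `∂_t u(0) = u₁`,
where `I` is a time interval starting at `0`. The equation is understood in the sense of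
distributions in `x`, the distribution `∂_t² u(t) = - a(t) ∂_t u(t) + Δ u(t)` being the
time derivative of `∂_t u`. -/
structure IsSolution (a : ℝ → ℝ) (I : Set ℝ) (u₀ : Sobolev n s) (u₁ : Sobolev n (s - 1))
    (u : ℝ → Sobolev n s) : Prop where
  continuousOn : ContinuousOn u I
  isC1 : IsCk 1 I u
  equation : ∀ φ : 𝓢(EuclideanSpace ℝ (Fin n), ℂ), ∀ t ∈ I,
    HasDerivWithinAt (fun τ ↦ (timeDeriv 1 I u τ).toDist φ)
      (Δ ((u t).toDist) φ - a t * (timeDeriv 1 I u t).toDist φ) I t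
  initial : u 0 = u₀
  initial_deriv : (timeDeriv 1 I u 0).toDist = u₁.toDist

/-- A net `(f_ε)`, `ε ∈ (0,1]`, of functions on `ℝ` is `C^∞`-moderate. -/
def IsModerate (f : ℝ → ℝ → ℝ) : Prop :=
  (∀ ε ∈ Ioc (0 : ℝ) 1, ContDiff ℝ ∞ (f ε)) ∧
    ∀ K : Set ℝ, IsCompact K → ∀ k : ℕ, ∃ N : ℕ, ∃ c : ℝ, 0 < c ∧
      ∀ ε ∈ Ioc (0 : ℝ) 1, ∀ t ∈ K, |iteratedDeriv k (f ε) t| ≤ c / ε ^ (N + k)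

/-- A net `(u_ε)`, `ε ∈ (0,1]`, is `C^∞([0,∞); H^s)`-moderate. -/
def IsSobolevModerate (u : ℝ → ℝ → Sobolev n s) : Prop :=
  (∀ ε ∈ Ioc (0 : ℝ) 1, ∀ k : ℕ, IsCk k (Ici 0) (u ε)) ∧
    ∃ N : ℕ, ∀ k : ℕ, ∃ c : ℝ, 0 < c ∧
      ∀ ε ∈ Ioc (0 : ℝ) 1, ∀ t ∈ Ici (0 : ℝ), ‖timeDeriv k (Ici 0) (u ε) t‖ ≤ c / ε ^ (N + k)

/-- A Friedrichs mollifier. -/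
structure IsMollifier (ψ : ℝ → ℝ) : Prop where
  smooth : ContDiff ℝ ∞ ψ
  compact : HasCompactSupport ψ
  nonneg : ∀ t, 0 ≤ ψ t
  integral_eq : ∫ t, ψ t = 1

/-- `(b_ε)`, `ε ∈ (0,1]`, is a regularising family of the positive function `b` on `[0,∞)`:
it is a `C^∞`-moderate net and `b_ε = B * ψ_{ρ(ε)}`, where `ψ_ρ(t) = ρ⁻¹ ψ(t/ρ)`, `ψ` is a
mollifier, `ρ(ε) > 0` tends to `0` with `ε`, and `B` is a positive locally Lipschitz function
on `ℝ` that extends `b` (convolution needs the values of `b` at negative times, too). -/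
def IsRegularisingFamily (b : ℝ → ℝ) (bε : ℝ → ℝ → ℝ) : Prop :=
  IsModerate bε ∧ ∃ ψ ρ B : ℝ → ℝ, IsMollifier ψ ∧
    (∀ ε ∈ Ioc (0 : ℝ) 1, 0 < ρ ε) ∧ Tendsto ρ (𝓝[>] 0) (𝓝 0) ∧
    EqOn B b (Ici 0) ∧ (∀ t, 0 < B t) ∧ LocallyLipschitz B ∧
    ∀ ε ∈ Ioc (0 : ℝ) 1,
      bε ε = B ⋆[ContinuousLinearMap.mul ℝ ℝ, volume] (fun t ↦ (ρ ε)⁻¹ * ψ (t / ρ ε))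

/-- `(u_ε)`, `ε ∈ (0,1]`, is a very weak solution of order `s`, with the regularising family
`(b_ε)`, of the Cauchy problem `∂_t² u - Δ u + (b'/b) ∂_t u = 0` in `[0,∞) × ℝⁿ`,
`u(0) = u₀`, `∂_t u(0) = u₁`. -/
structure IsVeryWeakSolution (b : ℝ → ℝ) (bε : ℝ → ℝ → ℝ) (u₀ : Sobolev n s)
    (u₁ : Sobolev n (s - 1)) (u : ℝ → ℝ → Sobolev n s) : Prop where
  regularising : IsRegularisingFamily b bε
  solves : ∀ ε ∈ Ioc (0 : ℝ) 1,
    IsSolution (fun t ↦ deriv (bε ε) t / bε ε t) (Ici 0) u₀ u₁ (u ε)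
  moderate : IsSobolevModerate u

/-- The coefficient `b'/b` on `[0,∞)`; the derivative at `0` is one-sided. -/
def dissipation (b : ℝ → ℝ) (t : ℝ) : ℝ := derivWithin b (Ici 0) t / b t

end DampedWave

end

/-! ### Linear ordinary differential equations in Banach spaces -/

/-! On the Fourier side put U = ⟨ξ⟩^s û and V = ⟨ξ⟩^(s-1) ∂_t û, both with values in L², and let J
be multiplication by ⟨ξ⟩⁻¹. Since |ξ|² = ⟨ξ⟩² - 1, the wave equation becomes (J U)' = V, (J V)' =
-κ²(1 - J²)U - a J V with κ = 2π: the Hilbert space system `IsDampedSystem`. Its unbounded part is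
skew for the energy κ²‖U‖² + ‖V‖². After truncation to |ξ| ≤ N only bounded terms remain in the
derivative of the energy, and a Gronwall argument followed by N → ∞ gives
`IsDampedSystem.energy_le`.

If two solutions have the same data and coefficients a' and a, their difference solves the system
for a' with source (a - a')V. Its energy is at most a constant times sup ‖V‖² ∫|a - a'|, where the
constant depends only on bounds for the coefficients. This stability statement,
`IsDampedSystem.tendstoUniformlyOn`, carries the convergence and, with a' = a, also uniqueness. For
existence, truncated data lead to a linear ODE with bounded operators, and by `energy_le` its
solutions form a Cauchy sequence as the truncation is removed.

It remains that b_ε'/b_ε → b'/b in L¹(0,T), boundedly: `IsRegularisingFamily.tendsto_integral`.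
Uniform convergence may fail, because the extension of b to negative times may have a kink at 0. But
b_ε' is bounded by a local Lipschitz constant of the extension and converges at every t > 0, so
dominated convergence applies. -/

section LinearODE

variable {E : Type*} [NormedAddCommGroup E] [NormedSpace ℝ E]

/-- The integrand is at most M/2 times the derivative of exp Λ. The factor 2 in Λ' is what later
makes the Picard map contract by 1/2. -/
theorem norm_integral_exp_smul_le {L : ℝ → E →L[ℝ] E} (hL : Continuous L) {Λ : ℝ → ℝ}
    (hΛ : ∀ t, HasDerivAt Λ (2 * ‖L t‖) t) {y : ℝ → E} {M : ℝ}
    (hM : ∀ t, ‖y t‖ ≤ M) {τ : ℝ} (hτ : 0 ≤ τ) :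
    ‖∫ s in (0 : ℝ)..τ, Real.exp (Λ s) • L s (y s)‖ ≤ M / 2 * Real.exp (Λ τ) := by
  have hM0 : 0 ≤ M := (norm_nonneg _).trans (hM 0)
  have hΛc : Continuous Λ := continuous_iff_continuousAt.2 fun t ↦ (hΛ t).continuousAt
  have hcont : Continuous fun s ↦ M / 2 * (Real.exp (Λ s) * (2 * ‖L s‖)) := by fun_prop
  have h1 : ∫ s in (0 : ℝ)..τ, M / 2 * (Real.exp (Λ s) * (2 * ‖L s‖)) =
      M / 2 * Real.exp (Λ τ) - M / 2 * Real.exp (Λ 0) :=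
    intervalIntegral.integral_eq_sub_of_hasDerivAt
      (fun t _ ↦ ((hΛ t).exp.const_mul (M / 2))) (hcont.intervalIntegrable _ _)
  refine (intervalIntegral.norm_integral_le_of_norm_le hτ (g := fun s ↦
    M / 2 * (Real.exp (Λ s) * (2 * ‖L s‖))) ?_ (hcont.intervalIntegrable _ _)).trans ?_
  · filter_upwards with s _
    rw [norm_smul, Real.norm_eq_abs, abs_of_pos (Real.exp_pos _)]
    have h2 : ‖L s (y s)‖ ≤ ‖L s‖ * M := (L s).le_of_opNorm_le_of_le le_rfl (hM s)
    calc Real.exp (Λ s) * ‖L s (y s)‖ ≤ Real.exp (Λ s) * (‖L s‖ * M) := by gcongr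
      _ = _ := by ring
  · rw [h1]
    have : 0 ≤ M / 2 * Real.exp (Λ 0) := by positivity
    linarith

variable [CompleteSpace E]

/-- A linear ordinary differential equation with continuous coefficients has a global solution. -/
theorem exists_solution_linear_ode (L : ℝ → E →L[ℝ] E) (hL : Continuous L) (x₀ : E) :
    ∃ x : ℝ → E, x 0 = x₀ ∧ ∀ t ∈ Ici (0 : ℝ), HasDerivWithinAt x (L t (x t)) (Ici 0) t := by
  set Λ : ℝ → ℝ := fun t ↦ ∫ s in (0 : ℝ)..t, 2 * ‖L s‖ with hΛdef
  have hΛ : ∀ t, HasDerivAt Λ (2 * ‖L t‖) t := fun t ↦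
    (Continuous.integral_hasStrictDerivAt (by fun_prop) 0 t).hasDerivAt
  have hΛc : Continuous Λ := continuous_iff_continuousAt.2 fun t ↦ (hΛ t).continuousAt
  have hint : ∀ y : BoundedContinuousFunction ℝ E,
      Continuous fun s ↦ Real.exp (Λ s) • L s (y s) := fun y ↦ by fun_prop
  have hint' : ∀ y : BoundedContinuousFunction ℝ E,
      Continuous fun t ↦ ∫ s in (0 : ℝ)..t, Real.exp (Λ s) • L s (y s) := fun y ↦
    intervalIntegral.continuous_primitive (fun a b ↦ (hint y).intervalIntegrable a b) 0
  have hΛnn : ∀ t, 0 ≤ Λ (max t 0) := fun t ↦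
    intervalIntegral.integral_nonneg (le_max_right _ _) fun s _ ↦ by positivity
  -- Picard iteration for the weighted unknown y = exp(-Λ) x, a contraction on the whole half-line
  -- at once. Through `max t 0` the functions are frozen at negative times.
  let Φ : BoundedContinuousFunction ℝ E → BoundedContinuousFunction ℝ E := fun y ↦
    BoundedContinuousFunction.ofNormedAddCommGroup
      (fun t ↦ Real.exp (-Λ (max t 0)) •
        (x₀ + ∫ s in (0 : ℝ)..(max t 0), Real.exp (Λ s) • L s (y s)))
      (by have := hint' y; fun_prop)
      (‖x₀‖ + ‖y‖ / 2) (fun t ↦ by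
        rw [norm_smul, Real.norm_eq_abs, abs_of_pos (Real.exp_pos _)]
        have h1 := norm_integral_exp_smul_le hL hΛ y.norm_coe_le_norm (le_max_right t 0)
        have h2 : Real.exp (-Λ (max t 0)) ≤ 1 := Real.exp_le_one_iff.2 (by linarith [hΛnn t])
        calc _ ≤ Real.exp (-Λ (max t 0)) * (‖x₀‖ + ‖y‖ / 2 * Real.exp (Λ (max t 0))) := by
              gcongr
              exact (norm_add_le _ _).trans (by gcongr)
          _ = Real.exp (-Λ (max t 0)) * ‖x₀‖ + ‖y‖ / 2 * (Real.exp (-Λ (max t 0)) *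
              Real.exp (Λ (max t 0))) := by ring
          _ = Real.exp (-Λ (max t 0)) * ‖x₀‖ + ‖y‖ / 2 := by
              rw [← Real.exp_add]; simp
          _ ≤ _ := by
              gcongr
              exact mul_le_of_le_one_left (norm_nonneg _) h2)
  have hΦ : ContractingWith (1 / 2) Φ := by
    refine ⟨by norm_num, LipschitzWith.of_dist_le_mul fun y z ↦ ?_⟩
    rw [BoundedContinuousFunction.dist_le (by positivity)]
    intro t
    have h1 := norm_integral_exp_smul_le hL hΛ (y - z).norm_coe_le_norm (le_max_right t 0)
    have h3 : (Φ y) t - (Φ z) t = Real.exp (-Λ (max t 0)) •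
        ∫ s in (0 : ℝ)..(max t 0), Real.exp (Λ s) • L s ((y - z) s) := by
      simp only [Φ, BoundedContinuousFunction.coe_ofNormedAddCommGroup, ← smul_sub,
        add_sub_add_left_eq_sub, BoundedContinuousFunction.coe_sub, Pi.sub_apply, map_sub]
      rw [← intervalIntegral.integral_sub ((hint y).intervalIntegrable _ _)
        ((hint z).intervalIntegrable _ _)]
      simp only [smul_sub]
    rw [dist_eq_norm, h3, norm_smul, Real.norm_eq_abs, abs_of_pos (Real.exp_pos _), dist_eq_norm]
    calc _ ≤ Real.exp (-Λ (max t 0)) * (‖y - z‖ / 2 * Real.exp (Λ (max t 0))) := by gcongr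
      _ = ‖y - z‖ / 2 * (Real.exp (-Λ (max t 0)) * Real.exp (Λ (max t 0))) := by ring
      _ = _ := by
        rw [← Real.exp_add]
        simp
        ring
  set y := hΦ.fixedPoint Φ
  have hy : Φ y = y := hΦ.fixedPoint_isFixedPt
  set x : ℝ → E := fun t ↦ x₀ + ∫ s in (0 : ℝ)..t, Real.exp (Λ s) • L s (y s) with hx
  refine ⟨x, by simp [hx], fun t ht ↦ ?_⟩
  have h1 : HasDerivAt x (Real.exp (Λ t) • L t (y t)) t :=
    ((hint y).integral_hasStrictDerivAt 0 t).hasDerivAt.const_add x₀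
  have h2 : y t = Real.exp (-Λ t) • x t := by
    conv_lhs => rw [← hy]
    simp [Φ, hx, max_eq_left (mem_Ici.1 ht)]
  convert h1.hasDerivWithinAt using 1
  rw [h2, map_smul, smul_smul, ← Real.exp_add]
  simp

end LinearODE

/-! ### Primitives on compact intervals -/

section Primitive

variable {E : Type*} [NormedAddCommGroup E] [NormedSpace ℝ E]

theorem exists_continuous_eqOn_Icc {X : Type*} [TopologicalSpace X] {g : ℝ → X}
    {T : ℝ} (hT : 0 ≤ T) (hg : ContinuousOn g (Icc 0 T)) : ∃ g' : ℝ → X, Continuous g' ∧ EqOn g g' (Icc 0 T) :=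
  ⟨IccExtend hT ((Icc 0 T).domRestrict g), hg.domRestrict.Icc_extend', fun t ht ↦ by
    rw [IccExtend_of_mem hT _ ht, domRestrict_apply]⟩

theorem exists_continuous_eqOn_Ici {X : Type*} [TopologicalSpace X] {g : ℝ → X}
    (hg : ContinuousOn g (Ici 0)) :
    
    ∃ g' : ℝ → X, Continuous g' ∧ EqOn g g' (Ici 0) :=
  ⟨fun t ↦ g (max t 0), hg.comp_continuous (by fun_prop) fun t ↦ le_max_right t 0,
    fun t ht ↦ by simp only [max_eq_left (mem_Ici.1 ht)]⟩

theorem integral_congr_of_eqOn_Icc {g g' : ℝ → E} {T t : ℝ} (h : EqOn g g' (Icc 0 T))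
    (ht : t ∈ Icc 0 T) : ∫ s in (0 : ℝ)..t, g s = ∫ s in (0 : ℝ)..t, g' s := by
  refine intervalIntegral.integral_congr fun s hs ↦ h ?_
  rw [uIcc_of_le ht.1] at hs
  exact ⟨hs.1, hs.2.trans ht.2⟩

theorem hasDerivWithinAt_Ici_of_Icc {f : ℝ → E} {f' : E} {T t : ℝ} (ht : t < T)
    (h : HasDerivWithinAt f f' (Icc 0 T) t) : HasDerivWithinAt f f' (Ici 0) t :=
  h.mono_of_mem_nhdsWithin
    (mem_nhdsWithin.2 ⟨Iio T, isOpen_Iio, ht, fun _ hx ↦ ⟨hx.2, hx.1.le⟩⟩)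

variable [CompleteSpace E]

/-- Extending g by constants makes the two-sided fundamental theorem available at the endpoints too.
-/
theorem hasDerivWithinAt_integral_Icc {g : ℝ → E} {T : ℝ} (hT : 0 ≤ T)
    (hg : ContinuousOn g (Icc 0 T)) {t : ℝ} (ht : t ∈ Icc 0 T) :
    HasDerivWithinAt (fun t ↦ ∫ s in (0 : ℝ)..t, g s) (g t) (Icc 0 T) t := by
  obtain ⟨g', hg', h⟩ := exists_continuous_eqOn_Icc hT hg
  rw [h ht]
  exact ((hg'.integral_hasStrictDerivAt 0 t).hasDerivAt.hasDerivWithinAt).congr_of_mem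
    (fun s hs ↦ integral_congr_of_eqOn_Icc h hs) ht

theorem eq_add_integral_of_hasDerivWithinAt {f g : ℝ → E} {T : ℝ} (hT : 0 ≤ T)
    (hg : ContinuousOn g (Icc 0 T))
    (hf : ∀ t ∈ Icc 0 T, HasDerivWithinAt f (g t) (Icc 0 T) t) {t : ℝ} (ht : t ∈ Icc 0 T) :
    f t = f 0 + ∫ s in (0 : ℝ)..t, g s := by
  have h : ∀ t ∈ Icc 0 T,
      HasDerivWithinAt (fun t ↦ f t - ∫ s in (0 : ℝ)..t, g s) 0 (Icc 0 T) t := fun t ht ↦ by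
    simpa using (hf t ht).fun_sub (hasDerivWithinAt_integral_Icc hT hg ht)
  have h2 := (convex_Icc (0 : ℝ) T).norm_image_sub_le_of_norm_hasDerivWithin_le (C := 0) h
    (by simp) (left_mem_Icc.2 hT) ht
  simp only [zero_mul, norm_le_zero_iff, intervalIntegral.integral_same, sub_zero] at h2
  rw [sub_eq_zero, sub_eq_iff_eq_add] at h2
  exact h2

/-- Uniform limits of continuously differentiable functions, on a compact interval. -/
theorem hasDerivWithinAt_of_tendstoUniformlyOn_Icc {f g : ℕ → ℝ → E} {f' g' : ℝ → E} {T : ℝ}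
    (hT : 0 ≤ T) (hg : ∀ n, ContinuousOn (g n) (Icc 0 T))
    (hf : ∀ n, ∀ t ∈ Icc 0 T, HasDerivWithinAt (f n) (g n t) (Icc 0 T) t)
    (hff : ∀ t ∈ Icc 0 T, Tendsto (fun n ↦ f n t) atTop (𝓝 (f' t)))
    (hgg : TendstoUniformlyOn g g' atTop (Icc 0 T)) {t : ℝ} (ht : t ∈ Icc 0 T) :
    HasDerivWithinAt f' (g' t) (Icc 0 T) t := by
  have hg' : ContinuousOn g' (Icc 0 T) := hgg.continuousOn (Frequently.of_forall hg)
  have h : ∀ t ∈ Icc 0 T, f' t = f' 0 + ∫ s in (0 : ℝ)..t, g' s := fun t ht ↦ by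
    have h1 : Tendsto (fun n ↦ f n 0 + ∫ s in (0 : ℝ)..t, g n s) atTop
        (𝓝 (f' 0 + ∫ s in (0 : ℝ)..t, g' s)) := by
      refine (hff 0 (left_mem_Icc.2 hT)).add ?_
      have h0 : uIcc 0 t ⊆ Icc 0 T := by
        rw [uIcc_of_le ht.1]
        exact Icc_subset_Icc_right ht.2
      exact TendstoUniformlyOn.tendsto_intervalIntegral_of_continuousOn
        (Eventually.of_forall fun n ↦ (hg n).mono h0) (hgg.mono h0)
    refine tendsto_nhds_unique (hff t ht) (h1.congr fun n ↦ ?_)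
    exact (eq_add_integral_of_hasDerivWithinAt hT (hg n) (hf n) ht).symm
  exact ((hasDerivWithinAt_integral_Icc hT hg' ht).const_add (f' 0)).congr_of_mem h ht

end Primitive

/-! ### An abstract damped wave equation in a Hilbert space -/

section Abstract

variable {H : Type*} [NormedAddCommGroup H] [InnerProductSpace ℝ H]

/-- Bounded operators `P N` that approximate the identity and the truncations `A N = P N ∘ J⁻¹`
of the unbounded inverse of `J`. -/
structure IsCutoff (J : H →L[ℝ] H) (A P : ℕ → H →L[ℝ] H) : Prop where
  apply_J : ∀ N x, A N (J x) = P N x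
  J_apply : ∀ N x, J (A N x) = P N x
  proj_apply : ∀ N x, P N (A N x) = A N x
  symm : ∀ N x y, inner ℝ (A N x) y = inner ℝ x (A N y)
  symm_J : ∀ x y, inner ℝ (J x) y = inner ℝ x (J y)
  norm_J_le : ∀ x, ‖J x‖ ≤ ‖x‖
  norm_proj_le : ∀ N x, ‖P N x‖ ≤ ‖x‖
  tendsto_proj : ∀ x, Tendsto (fun N ↦ P N x) atTop (𝓝 x)

namespace IsCutoff

variable {J : H →L[ℝ] H} {A P : ℕ → H →L[ℝ] H}

/-- Taking adjoints exchanges the two factorisations P = A J = J A. -/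
theorem symm_proj (hc : IsCutoff J A P) (N : ℕ) (x y : H) :
    inner ℝ (P N x) y = inner ℝ x (P N y) := by
  rw [← hc.apply_J, hc.symm, hc.symm_J, hc.J_apply]

theorem J_proj (hc : IsCutoff J A P) (N : ℕ) (x : H) : J (P N x) = P N (J x) := by
  rw [← hc.apply_J, hc.J_apply, ← hc.apply_J, hc.apply_J]

theorem proj_proj (hc : IsCutoff J A P) (N : ℕ) (x : H) : P N (P N x) = P N x := by
  rw [← hc.apply_J N x, hc.proj_apply]

end IsCutoff

/-- `J U' = V` and `J V' = -κ² (1 - J²) U - a J V + J G`, the form that the damped wave equation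
takes on the Fourier side. -/
structure IsDampedSystem (κ : ℝ) (J : H →L[ℝ] H) (a : ℝ → ℝ) (G : ℝ → H) (I : Set ℝ)
    (U V : ℝ → H) : Prop where
  continuousOn_fst : ContinuousOn U I
  continuousOn_snd : ContinuousOn V I
  deriv_fst : ∀ t ∈ I, HasDerivWithinAt (fun τ ↦ J (U τ)) (V t) I t
  deriv_snd : ∀ t ∈ I, HasDerivWithinAt (fun τ ↦ J (V τ))
    (-κ ^ 2 • (U t - J (J (U t))) - a t • J (V t) + J (G t)) I t

namespace IsDampedSystem

variable {κ : ℝ} {J : H →L[ℝ] H} {A P : ℕ → H →L[ℝ] H} {a : ℝ → ℝ} {G : ℝ → H} {I : Set ℝ}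
  {U V : ℝ → H}

theorem mono (h : IsDampedSystem κ J a G I U V) {I' : Set ℝ} (hI : I' ⊆ I) :
    IsDampedSystem κ J a G I' U V :=
  ⟨h.1.mono hI, h.2.mono hI, fun t ht ↦ (h.3 t (hI ht)).mono hI,
    fun t ht ↦ (h.4 t (hI ht)).mono hI⟩

/-- From a V - a' V' = a (V - V') - (a' - a) V'. The source involves only the velocity of the
subtracted solution. -/
theorem sub {a' : ℝ → ℝ} {U' V' : ℝ → H} (h : IsDampedSystem κ J a 0 I U V)
    (h' : IsDampedSystem κ J a' 0 I U' V') :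
    IsDampedSystem κ J a (fun t ↦ (a' t - a t) • V' t) I (fun t ↦ U t - U' t)
      (fun t ↦ V t - V' t) := by
  refine ⟨h.1.sub h'.1, h.2.sub h'.2, fun t ht ↦ ?_, fun t ht ↦ ?_⟩
  · simpa only [map_sub] using (h.3 t ht).fun_sub (h'.3 t ht)
  · simp only [map_sub]
    refine ((h.4 t ht).fun_sub (h'.4 t ht)).congr_deriv ?_
    simp only [map_smul, Pi.zero_apply, map_zero, add_zero]
    module

/-- Only J U and J V are known to be differentiable; applying the bounded operator A N recovers
derivatives of truncations of U and V themselves. -/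
theorem hasDerivWithinAt_proj_fst (hc : IsCutoff J A P) (h : IsDampedSystem κ J a G I U V)
    (N : ℕ) {t : ℝ} (ht : t ∈ I) :
    HasDerivWithinAt (fun τ ↦ P N (U τ)) (A N (V t)) I t := by
  simpa only [Function.comp_def, hc.apply_J] using
    (A N).hasFDerivAt.comp_hasDerivWithinAt t (h.3 t ht)

theorem hasDerivWithinAt_proj_snd (hc : IsCutoff J A P) (h : IsDampedSystem κ J a G I U V)
    (N : ℕ) {t : ℝ} (ht : t ∈ I) :
    HasDerivWithinAt (fun τ ↦ P N (V τ))
      (-κ ^ 2 • (A N (U t) - P N (J (U t))) - a t • P N (V t) + P N (G t)) I t := by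
  have := (A N).hasFDerivAt.comp_hasDerivWithinAt t (h.4 t ht)
  simpa only [Function.comp_def, hc.apply_J, map_add, map_sub, map_smul] using this

/-- The derivative of the truncated energy. -/
theorem hasDerivWithinAt_energy (hc : IsCutoff J A P) (h : IsDampedSystem κ J a G I U V)
    (N : ℕ) {t : ℝ} (ht : t ∈ I) :
    HasDerivWithinAt (fun τ ↦ κ ^ 2 * ‖P N (U τ)‖ ^ 2 + ‖P N (V τ)‖ ^ 2)
      (2 * κ ^ 2 * inner ℝ (P N (V t)) (J (P N (U t))) - 2 * a t * ‖P N (V t)‖ ^ 2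
        + 2 * inner ℝ (P N (V t)) (P N (G t))) I t := by
  have h1 := ((h.hasDerivWithinAt_proj_fst hc N ht).norm_sq.const_mul (κ ^ 2)).fun_add
    (h.hasDerivWithinAt_proj_snd hc N ht).norm_sq
  refine h1.congr_deriv ?_
  -- By symmetry of A N the two terms whose size grows with N cancel.
  have h2 : inner ℝ (P N (U t)) (A N (V t)) = inner ℝ (P N (V t)) (A N (U t)) := by
    rw [hc.symm_proj, hc.proj_apply, hc.symm_proj, hc.proj_apply, ← hc.symm, real_inner_comm]
  simp only [inner_add_right, inner_sub_right, inner_smul_right, real_inner_self_eq_norm_sq, h2,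
    hc.J_proj]
  ring

/-- The energy estimate. -/
theorem energy_le (hκ : 0 < κ) (hc : IsCutoff J A P) {T : ℝ} (hT : 0 ≤ T)
    (h : IsDampedSystem κ J a G (Icc 0 T) U V) {α γ₀ C : ℝ} {γ : ℝ → ℝ}
    (hα : ∀ t ∈ Icc 0 T, |a t| ≤ α) (hγ : ContinuousOn γ (Icc 0 T))
    (hγ0 : ∀ t ∈ Icc 0 T, 0 ≤ γ t) (hγ1 : ∀ t ∈ Icc 0 T, γ t ≤ γ₀)
    (hG : ∀ t ∈ Icc 0 T, ‖G t‖ ≤ γ t * C) {t : ℝ} (ht : t ∈ Icc 0 T) :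
    κ ^ 2 * ‖U t‖ ^ 2 + ‖V t‖ ^ 2 ≤ Real.exp ((κ + 2 * α + γ₀) * t) *
      (κ ^ 2 * ‖U 0‖ ^ 2 + ‖V 0‖ ^ 2 + C ^ 2 * ∫ s in (0 : ℝ)..t, γ s) := by
  -- κ absorbs the cross term with J, 2α the damping term of either sign, and γ₀ the part γ‖P V‖² of
  -- the source term. None depends on N.
  set K := κ + 2 * α + γ₀ with hK
  have h0 : (0 : ℝ) ∈ Icc 0 T := left_mem_Icc.2 hT
  have hα0 : 0 ≤ α := (abs_nonneg _).trans (hα 0 h0)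
  have hγ₀ : 0 ≤ γ₀ := (hγ0 0 h0).trans (hγ1 0 h0)
  have key : ∀ N, κ ^ 2 * ‖P N (U t)‖ ^ 2 + ‖P N (V t)‖ ^ 2 ≤ Real.exp (K * t) *
      (κ ^ 2 * ‖P N (U 0)‖ ^ 2 + ‖P N (V 0)‖ ^ 2 + C ^ 2 * ∫ s in (0 : ℝ)..t, γ s) := by
    intro N
    set E : ℝ → ℝ := fun τ ↦ κ ^ 2 * ‖P N (U τ)‖ ^ 2 + ‖P N (V τ)‖ ^ 2 with hE
    set E' : ℝ → ℝ := fun t ↦ 2 * κ ^ 2 * inner ℝ (P N (V t)) (J (P N (U t)))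
      - 2 * a t * ‖P N (V t)‖ ^ 2 + 2 * inner ℝ (P N (V t)) (P N (G t)) with hE'
    -- Gronwall's argument: this function will be nonincreasing, since 2‖P V‖γC ≤ γ‖P V‖² + γC².
    have hd : ∀ t ∈ Icc 0 T, HasDerivWithinAt
        (fun τ ↦ Real.exp (-K * τ) * E τ - C ^ 2 * ∫ s in (0 : ℝ)..τ, γ s)
        (Real.exp (-K * t) * (E' t - K * E t) - C ^ 2 * γ t) (Icc 0 T) t := fun t ht ↦ by
      have h1 : HasDerivWithinAt (fun τ ↦ Real.exp (-K * τ)) (Real.exp (-K * t) * (-K))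
          (Icc 0 T) t := by
        simpa using ((hasDerivAt_id t).const_mul (-K)).exp.hasDerivWithinAt
      refine ((h1.fun_mul (h.hasDerivWithinAt_energy hc N ht)).fun_sub
        ((hasDerivWithinAt_integral_Icc hT hγ ht).const_mul (C ^ 2))).congr_deriv ?_
      simp only [hE, hE']
      ring
    have hle : ∀ t ∈ Icc 0 T, Real.exp (-K * t) * (E' t - K * E t) - C ^ 2 * γ t ≤ 0 := by
      intro t ht
      have h1 : inner ℝ (P N (V t)) (J (P N (U t))) ≤ ‖P N (V t)‖ * ‖P N (U t)‖ :=
        (real_inner_le_norm _ _).trans (by gcongr; exact hc.norm_J_le _)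
      have h2 : inner ℝ (P N (V t)) (P N (G t)) ≤ ‖P N (V t)‖ * (γ t * C) :=
        (real_inner_le_norm _ _).trans
          (by gcongr; exact (hc.norm_proj_le _ _).trans (hG t ht))
      have h3 : -a t ≤ α := (neg_le_abs _).trans (hα t ht)
      have h4 : E' t - K * E t ≤ γ t * C ^ 2 := by
        simp only [hE, hE', hK]
        set p := ‖P N (V t)‖
        set q := ‖P N (U t)‖
        have e1 : 2 * κ ^ 2 * inner ℝ (P N (V t)) (J (P N (U t))) ≤
            κ * (κ ^ 2 * q ^ 2 + p ^ 2) := by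
          have : 2 * κ ^ 2 * inner ℝ (P N (V t)) (J (P N (U t))) ≤ 2 * κ ^ 2 * (p * q) := by gcongr
          nlinarith [mul_nonneg hκ.le (sq_nonneg (κ * q - p))]
        have e2 : -2 * a t * p ^ 2 ≤ 2 * α * p ^ 2 := by nlinarith [sq_nonneg p]
        have e3 : 2 * (p * (γ t * C)) ≤ γ t * p ^ 2 + γ t * C ^ 2 := by
          nlinarith [mul_nonneg (hγ0 t ht) (sq_nonneg (p - C))]
        have e4 : γ t * p ^ 2 ≤ γ₀ * p ^ 2 := by
          have := hγ1 t ht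
          gcongr
        have e5 : 0 ≤ (2 * α + γ₀) * (κ ^ 2 * q ^ 2) := by positivity
        nlinarith
      have h5 : Real.exp (-K * t) ≤ 1 := Real.exp_le_one_iff.2 (by
        have : 0 ≤ K := by positivity
        nlinarith [ht.1])
      have h6 : Real.exp (-K * t) * (E' t - K * E t) ≤ Real.exp (-K * t) * (γ t * C ^ 2) := by
        gcongr
      have h7 : Real.exp (-K * t) * (γ t * C ^ 2) ≤ γ t * C ^ 2 :=
        mul_le_of_le_one_left (mul_nonneg (hγ0 t ht) (sq_nonneg _)) h5
      linarith
    have hanti := antitoneOn_of_hasDerivWithinAt_nonpos (convex_Icc 0 T)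
      (fun t ht ↦ (hd t ht).continuousWithinAt)
      (fun t ht ↦ (hd t (interior_subset ht)).mono interior_subset)
      (fun t ht ↦ hle t (interior_subset ht)) h0 ht ht.1
    simp only [mul_zero, Real.exp_zero, one_mul, intervalIntegral.integral_same, sub_zero,
      tsub_le_iff_right] at hanti
    calc E t = Real.exp (K * t) * (Real.exp (-K * t) * E t) := by
          rw [← mul_assoc, ← Real.exp_add]
          simp
      _ ≤ _ := by gcongr
  refine le_of_tendsto_of_tendsto' (b := atTop) ?_ ?_ key
  · exact (((hc.tendsto_proj _).norm.pow 2).const_mul _).add ((hc.tendsto_proj _).norm.pow 2)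
  · exact (((((hc.tendsto_proj _).norm.pow 2).const_mul _).add
      ((hc.tendsto_proj _).norm.pow 2)).add_const _).const_mul _

theorem norm_lt_of_energy_lt {κ p q δ : ℝ} (hδ : 0 ≤ δ)
    (h : κ ^ 2 * p ^ 2 + q ^ 2 < min (κ ^ 2) 1 * δ ^ 2) : p < δ ∧ q < δ := by
  have h1 : min (κ ^ 2) 1 * δ ^ 2 ≤ κ ^ 2 * δ ^ 2 := by gcongr; exact min_le_left _ _
  have h2 : min (κ ^ 2) 1 * δ ^ 2 ≤ 1 * δ ^ 2 := by gcongr; exact min_le_right _ _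
  constructor
  · have : κ ^ 2 * p ^ 2 < κ ^ 2 * δ ^ 2 := by nlinarith [sq_nonneg q]
    exact lt_of_pow_lt_pow_left₀ 2 hδ (lt_of_mul_lt_mul_left this (sq_nonneg κ))
  · exact lt_of_pow_lt_pow_left₀ 2 hδ (by nlinarith [mul_nonneg (sq_nonneg κ) (sq_nonneg p)])

/-- The solutions depend continuously on the coefficient, with respect to bounded convergence
in `L¹`. -/
theorem tendstoUniformlyOn (hκ : 0 < κ) (hc : IsCutoff J A P) {T : ℝ} (hT : 0 ≤ T)
    (h : IsDampedSystem κ J a 0 (Icc 0 T) U V) (ha : ContinuousOn a (Icc 0 T))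
    {ι : Type*} {l : Filter ι} {a' : ι → ℝ → ℝ} {U' V' : ι → ℝ → H}
    (h' : ∀ᶠ i in l, IsDampedSystem κ J (a' i) 0 (Icc 0 T) (U' i) (V' i))
    (hU : ∀ᶠ i in l, U' i 0 = U 0) (hV : ∀ᶠ i in l, V' i 0 = V 0)
    (ha' : ∀ᶠ i in l, ContinuousOn (a' i) (Icc 0 T)) {α : ℝ}
    (hα : ∀ᶠ i in l, ∀ t ∈ Icc 0 T, |a' i t| ≤ α)
    (hlim : Tendsto (fun i ↦ ∫ t in (0 : ℝ)..T, |a t - a' i t|) l (𝓝 0)) :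
    TendstoUniformlyOn U' U l (Icc 0 T) ∧ TendstoUniformlyOn V' V l (Icc 0 T) := by
  have h0 : (0 : ℝ) ∈ Icc 0 T := left_mem_Icc.2 hT
  obtain ⟨β, hβ⟩ := isCompact_Icc.exists_bound_of_continuousOn ha
  obtain ⟨C, hC⟩ := isCompact_Icc.exists_bound_of_continuousOn h.2
  have hβ0 : 0 ≤ β := (norm_nonneg _).trans (hβ 0 h0)
  -- The bound by α holds only eventually, so for a trivial filter its sign is unknown; hence |α|.
  have hlim' : Tendsto (fun i ↦ Real.exp ((κ + 2 * |α| + (β + |α|)) * T) *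
      (C ^ 2 * ∫ t in (0 : ℝ)..T, |a t - a' i t|)) l (𝓝 0) := by
    simpa using (hlim.const_mul (C ^ 2)).const_mul (Real.exp ((κ + 2 * |α| + (β + |α|)) * T))
  have key : ∀ δ > 0, ∀ᶠ i in l, ∀ t ∈ Icc 0 T, ‖U' i t - U t‖ < δ ∧ ‖V' i t - V t‖ < δ := by
    intro δ hδ
    have hδ' : 0 < min (κ ^ 2) 1 * δ ^ 2 := by positivity
    filter_upwards [h', hU, hV, ha', hα, hlim'.eventually (gt_mem_nhds hδ')]
      with i h' hU hV ha' hα hlim t ht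
    refine norm_lt_of_energy_lt hδ.le (lt_of_le_of_lt ?_ hlim)
    have hα' : ∀ t ∈ Icc 0 T, |a' i t| ≤ |α| := fun t ht ↦ (hα t ht).trans (le_abs_self α)
    have hcont : ContinuousOn (fun t ↦ |a t - a' i t|) (Icc 0 T) := (ha.sub ha').abs
    -- Subtracting in this order puts the fixed velocity V into the source, so that C is independent
    -- of i.
    have e := (h'.sub h).energy_le hκ hc hT (α := |α|) (γ₀ := β + |α|) (C := C)
      (γ := fun t ↦ |a t - a' i t|) hα' hcont (fun t _ ↦ abs_nonneg _)
      (fun t ht ↦ (abs_sub _ _).trans (add_le_add (hβ t ht) (hα' t ht)))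
      (fun t ht ↦ by
        rw [norm_smul, Real.norm_eq_abs]
        gcongr
        exact hC t ht) ht
    refine e.trans ?_
    simp only [hU, hV, sub_self, norm_zero, ne_eq, OfNat.ofNat_ne_zero, not_false_eq_true,
      zero_pow, mul_zero, add_zero, zero_add]
    have hi : ∫ s in (0 : ℝ)..t, |a s - a' i s| ≤ ∫ s in (0 : ℝ)..T, |a s - a' i s| :=
      intervalIntegral.integral_mono_interval le_rfl ht.1 ht.2
        (Eventually.of_forall fun _ ↦ abs_nonneg _)
        (hcont.intervalIntegrable_of_Icc hT)
    have hi0 : 0 ≤ ∫ s in (0 : ℝ)..t, |a s - a' i s| :=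
      intervalIntegral.integral_nonneg ht.1 fun _ _ ↦ abs_nonneg _
    have := ht.2
    gcongr
  constructor <;> rw [Metric.tendstoUniformlyOn_iff] <;> intro δ hδ <;>
    filter_upwards [key δ hδ] with i hi t ht <;> rw [dist_comm, dist_eq_norm]
  · exact (hi t ht).1
  · exact (hi t ht).2

/-- Stability for a constant sequence of coefficients and solutions: the constant U' converges to U.
-/
theorem eqOn (hκ : 0 < κ) (hc : IsCutoff J A P) {T : ℝ} (hT : 0 ≤ T)
    (h : IsDampedSystem κ J a 0 (Icc 0 T) U V) (ha : ContinuousOn a (Icc 0 T))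
    {U' V' : ℝ → H} (h' : IsDampedSystem κ J a 0 (Icc 0 T) U' V')
    (hU : U' 0 = U 0) (hV : V' 0 = V 0) : EqOn U' U (Icc 0 T) := by
  obtain ⟨α, hα⟩ := isCompact_Icc.exists_bound_of_continuousOn ha
  have := (tendstoUniformlyOn hκ hc hT h ha (l := (atTop : Filter ℕ)) (a' := fun _ ↦ a)
    (U' := fun _ ↦ U') (V' := fun _ ↦ V') (.of_forall fun _ ↦ h') (.of_forall fun _ ↦ hU)
    (.of_forall fun _ ↦ hV) (.of_forall fun _ ↦ ha) (.of_forall fun _ ↦ hα) (by simp)).1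
  exact fun t ht ↦ tendsto_nhds_unique tendsto_const_nhds (this.tendsto_at ht)

variable [CompleteSpace H]

theorem exists_truncated_solution (hc : IsCutoff J A P) (ha : ContinuousOn a (Ici 0)) (x y : H)
    (N : ℕ) : ∃ U V : ℝ → H, U 0 = P N x ∧ V 0 = P N y ∧
      IsDampedSystem κ J a 0 (Ici 0) U V := by
  obtain ⟨a', ha', haa⟩ := exists_continuous_eqOn_Ici ha
  set π₁ := ContinuousLinearMap.fst ℝ H H
  set π₂ := ContinuousLinearMap.snd ℝ H H
  -- The system solved for (U', V'), with the unbounded J⁻¹ replaced by A N.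
  let L : ℝ → (H × H) →L[ℝ] (H × H) := fun t ↦
    ((A N).comp π₂).prod (-κ ^ 2 • ((A N).comp π₁ - (P N).comp (J.comp π₁))) -
      a' t • (0 : H × H →L[ℝ] H).prod π₂
  have hL : Continuous L := by fun_prop
  obtain ⟨z, hz0, hz⟩ := exists_solution_linear_ode L hL (x, y)
  have hd1 : ∀ t ∈ Ici (0 : ℝ), HasDerivWithinAt (fun τ ↦ (z τ).1) (A N (z t).2) (Ici 0) t :=
    fun t ht ↦ by
      simpa [L, Function.comp_def, π₁, π₂] using
        π₁.hasFDerivAt.comp_hasDerivWithinAt t (hz t ht)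
  have hd2 : ∀ t ∈ Ici (0 : ℝ), HasDerivWithinAt (fun τ ↦ (z τ).2)
      (-κ ^ 2 • (A N (z t).1 - P N (J (z t).1)) - a t • (z t).2) (Ici 0) t :=
    fun t ht ↦ by
      rw [haa ht]
      exact (π₂.hasFDerivAt.comp_hasDerivWithinAt t (hz t ht)).congr_deriv
        (by simp [L, π₁, π₂])
  have hzc : ContinuousOn z (Ici 0) := fun t ht ↦ (hz t ht).continuousWithinAt
  -- On the range of P N the operator A N inverts J, so the projected curve solves the original
  -- system exactly, with truncated data.
  refine ⟨fun t ↦ P N (z t).1, fun t ↦ P N (z t).2, by simp [hz0], by simp [hz0], ?_, ?_, ?_, ?_⟩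
  · exact (P N).continuous.comp_continuousOn hzc.fst
  · exact (P N).continuous.comp_continuousOn hzc.snd
  · intro t ht
    refine ((J.comp (P N)).hasFDerivAt.comp_hasDerivWithinAt t (hd1 t ht)).congr_deriv ?_
    simp [hc.proj_apply, hc.J_apply]
  · intro t ht
    refine ((J.comp (P N)).hasFDerivAt.comp_hasDerivWithinAt t (hd2 t ht)).congr_deriv ?_
    simp [hc.proj_apply, hc.J_apply, hc.J_proj, hc.proj_proj]

/-- Existence of solutions of the damped wave equation. -/
theorem exists_solution (hκ : 0 < κ) (hc : IsCutoff J A P) (ha : ContinuousOn a (Ici 0))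
    (x y : H) : ∃ U V : ℝ → H, U 0 = x ∧ V 0 = y ∧ IsDampedSystem κ J a 0 (Ici 0) U V := by
  choose U V hU hV h using exists_truncated_solution (κ := κ) hc ha x y
  have hIcc : ∀ T : ℝ, Icc 0 T ⊆ Ici 0 := fun T ↦ Icc_subset_Ici_self
  have hcauchy : ∀ T, 0 ≤ T → UniformCauchySeqOn U atTop (Icc 0 T) ∧
      UniformCauchySeqOn V atTop (Icc 0 T) := by
    intro T hT
    obtain ⟨α, hα⟩ := isCompact_Icc.exists_bound_of_continuousOn (ha.mono (hIcc T))
    have hα0 : 0 ≤ α := (norm_nonneg _).trans (hα 0 (left_mem_Icc.2 hT))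
    have hdist : ∀ x, Tendsto (fun n : ℕ × ℕ ↦ ‖P n.1 x - P n.2 x‖) atTop (𝓝 0) := fun x ↦ by
      simpa only [dist_eq_norm] using
        cauchySeq_iff_tendsto_dist_atTop_0.1 (hc.tendsto_proj x).cauchySeq
    have hlim : Tendsto (fun n : ℕ × ℕ ↦ Real.exp ((κ + 2 * α + 0) * T) *
        (κ ^ 2 * ‖P n.1 x - P n.2 x‖ ^ 2 + ‖P n.1 y - P n.2 y‖ ^ 2)) atTop (𝓝 0) := by
      simpa using ((((hdist x).pow 2).const_mul (κ ^ 2)).add ((hdist y).pow 2)).const_mul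
        (Real.exp ((κ + 2 * α + 0) * T))
    have key : ∀ δ > 0, ∃ N, ∀ m ≥ N, ∀ n ≥ N, ∀ t ∈ Icc 0 T,
        ‖U m t - U n t‖ < δ ∧ ‖V m t - V n t‖ < δ := by
      intro δ hδ
      have hδ' : 0 < min (κ ^ 2) 1 * δ ^ 2 := by positivity
      obtain ⟨N, hN⟩ := eventually_atTop_prod_self.1 (hlim.eventually (gt_mem_nhds hδ'))
      refine ⟨N, fun m hm n hn t ht ↦ ?_⟩
      refine norm_lt_of_energy_lt hδ.le (lt_of_le_of_lt ?_ (hN m n hm hn))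
      -- Both solutions have the coefficient a, so the source vanishes and only the difference of
      -- the data counts.
      have e := (((h m).mono (hIcc T)).sub ((h n).mono (hIcc T))).energy_le hκ hc hT (α := α)
        (γ₀ := 0) (C := 0) (γ := fun _ ↦ 0) hα continuousOn_const (by simp) (by simp) (by simp) ht
      refine e.trans ?_
      simp only [hU, hV, intervalIntegral.integral_zero, mul_zero, add_zero]
      have := ht.2
      gcongr
    constructor <;> rw [Metric.uniformCauchySeqOn_iff] <;> intro δ hδ <;>
      obtain ⟨N, hN⟩ := key δ hδ <;> refine ⟨N, fun m hm n hn t ht ↦ ?_⟩ <;> rw [dist_eq_norm]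
    · exact (hN m hm n hn t ht).1
    · exact (hN m hm n hn t ht).2
  have hex : ∀ t, ∃ u v, 0 ≤ t → Tendsto (fun N ↦ U N t) atTop (𝓝 u) ∧
      Tendsto (fun N ↦ V N t) atTop (𝓝 v) := by
    intro t
    by_cases ht : 0 ≤ t
    · obtain ⟨u, hu⟩ := cauchySeq_tendsto_of_complete
        ((hcauchy t ht).1.cauchySeq (right_mem_Icc.2 ht))
      obtain ⟨v, hv⟩ := cauchySeq_tendsto_of_complete
        ((hcauchy t ht).2.cauchySeq (right_mem_Icc.2 ht))
      exact ⟨u, v, fun _ ↦ ⟨hu, hv⟩⟩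
    · exact ⟨0, 0, fun h ↦ absurd h ht⟩
  choose u v huv using hex
  have hunif : ∀ T, 0 ≤ T → TendstoUniformlyOn U u atTop (Icc 0 T) ∧
      TendstoUniformlyOn V v atTop (Icc 0 T) := fun T hT ↦
    ⟨(hcauchy T hT).1.tendstoUniformlyOn_of_tendsto fun t ht ↦ (huv t ht.1).1,
      (hcauchy T hT).2.tendstoUniformlyOn_of_tendsto fun t ht ↦ (huv t ht.1).2⟩
  have hcont : ∀ {f : ℝ → H}, (∀ T, 0 ≤ T → ContinuousOn f (Icc 0 T)) → ContinuousOn f (Ici 0) :=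
    fun {f} hf t ht ↦ by
      have h1 : t < t + 1 := lt_add_one t
      refine (hf (t + 1) (le_trans ht h1.le) t ⟨ht, h1.le⟩).mono_of_mem_nhdsWithin ?_
      exact mem_nhdsWithin.2 ⟨Iio (t + 1), isOpen_Iio, h1, fun _ hx ↦ ⟨hx.2, hx.1.le⟩⟩
  refine ⟨u, v, tendsto_nhds_unique (huv 0 le_rfl).1 ?_, tendsto_nhds_unique (huv 0 le_rfl).2 ?_,
    hcont fun T hT ↦ (hunif T hT).1.continuousOn
      (Frequently.of_forall fun n ↦ ((h n).mono (hIcc T)).1),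
    hcont fun T hT ↦ (hunif T hT).2.continuousOn
      (Frequently.of_forall fun n ↦ ((h n).mono (hIcc T)).2), ?_, ?_⟩
  · simpa only [hU] using hc.tendsto_proj x
  · simpa only [hV] using hc.tendsto_proj y
  · intro t ht
    -- The limit is taken on [0, t + 1], a neighbourhood of t in the half-line.
    have h1 : t < t + 1 := lt_add_one t
    have hT : 0 ≤ t + 1 := le_trans ht h1.le
    refine hasDerivWithinAt_Ici_of_Icc h1 ?_
    exact hasDerivWithinAt_of_tendstoUniformlyOn_Icc hT (fun n ↦ ((h n).mono (hIcc _)).2)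
      (fun n ↦ ((h n).mono (hIcc _)).3)
      (fun s hs ↦ (J.continuous.tendsto _).comp (huv s hs.1).1) (hunif _ hT).2 ⟨ht, h1.le⟩
  · intro t ht
    have h1 : t < t + 1 := lt_add_one t
    have hT : 0 ≤ t + 1 := le_trans ht h1.le
    obtain ⟨α, hα⟩ := isCompact_Icc.exists_bound_of_continuousOn (ha.mono (hIcc (t + 1)))
    have hα0 : 0 ≤ α := (norm_nonneg _).trans (hα 0 (left_mem_Icc.2 hT))
    refine hasDerivWithinAt_Ici_of_Icc h1 ?_
    refine hasDerivWithinAt_of_tendstoUniformlyOn_Icc (f := fun n t ↦ J (V n t))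
      (g := fun n t ↦ -κ ^ 2 • (U n t - J (J (U n t))) - a t • J (V n t) + J ((0 : ℝ → H) t))
      (f' := fun t ↦ J (v t))
      (g' := fun t ↦ -κ ^ 2 • (u t - J (J (u t))) - a t • J (v t) + J ((0 : ℝ → H) t)) hT
      (fun n ↦ ?_) (fun n ↦ ((h n).mono (hIcc _)).4)
      (fun s hs ↦ (J.continuous.tendsto _).comp (huv s hs.1).2) ?_ ⟨ht, h1.le⟩
    · have c1 := ((h n).mono (hIcc (t + 1))).1
      have c2 := ((h n).mono (hIcc (t + 1))).2
      have c3 := ha.mono (hIcc (t + 1))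
      simp only [Pi.zero_apply]
      fun_prop
    · have e1 := (-κ ^ 2 • (ContinuousLinearMap.id ℝ H - J.comp J)).uniformContinuous
        |>.comp_tendstoUniformlyOn (hunif _ hT).1
      have e2 : TendstoUniformlyOn (fun n t ↦ a t • J (V n t)) (fun t ↦ a t • J (v t)) atTop
          (Icc 0 (t + 1)) := by
        rw [Metric.tendstoUniformlyOn_iff]
        intro δ hδ
        -- α may be zero, hence α + 1.
        filter_upwards [Metric.tendstoUniformlyOn_iff.1 (hunif _ hT).2 (δ / (α + 1))
          (by positivity)] with n hn s hs
        have h2 := hn s hs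
        rw [lt_div_iff₀ (by positivity), dist_eq_norm] at h2
        rw [dist_eq_norm, ← smul_sub, ← map_sub, norm_smul]
        have h3 := hα s hs
        have h4 := hc.norm_J_le (v s - V n s)
        calc ‖a s‖ * ‖J (v s - V n s)‖ ≤ α * ‖v s - V n s‖ := by gcongr
          _ ≤ ‖v s - V n s‖ * (α + 1) := by linarith [norm_nonneg (v s - V n s)]
          _ < δ := h2
      simpa [Function.comp_def, Pi.sub_def] using e1.sub e2

end IsDampedSystem

end Abstract

noncomputable section

namespace DampedWave

open scoped FourierTransform ENNReal

/-! ### Multiplication operators on the Fourier side -/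

/-- The space `L²(ℝⁿ)` of the Fourier transforms, as a complex Hilbert space. -/
def FreqSpace (n : ℕ) : Type := Lp ℂ 2 (volume : Measure (EuclideanSpace ℝ (Fin n)))

namespace FreqSpace

variable {n : ℕ}

local notation "𝔼" => EuclideanSpace ℝ (Fin n)

instance : NormedAddCommGroup (FreqSpace n) :=
  inferInstanceAs (NormedAddCommGroup (Lp ℂ 2 (volume : Measure 𝔼)))

instance : InnerProductSpace ℂ (FreqSpace n) :=
  inferInstanceAs (InnerProductSpace ℂ (Lp ℂ 2 (volume : Measure 𝔼)))

instance : InnerProductSpace ℝ (FreqSpace n) := InnerProductSpace.complexToReal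

instance : CompleteSpace (FreqSpace n) :=
  inferInstanceAs (CompleteSpace (Lp ℂ 2 (volume : Measure 𝔼)))

/-- An element of `FreqSpace n`, as an element of `L²`. -/
def toL2 (f : FreqSpace n) : Lp ℂ 2 (volume : Measure 𝔼) := f

/-- The inclusion of `L²` into the tempered distributions. -/
def toDist : FreqSpace n →L[ℂ] 𝓢'(𝔼, ℂ) := Lp.toTemperedDistributionCLM ℂ volume 2

theorem toDist_injective : Function.Injective (toDist (n := n)) := fun _ _ h ↦ Sobolev.lp_ext h

/-- The almost everywhere defined function that an element of `L²` represents. -/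
def fn (f : FreqSpace n) : 𝔼 → ℂ := f.toL2

theorem ext_fn {f g : FreqSpace n} (h : f.fn =ᵐ[volume] g.fn) : f = g := Lp.ext h

/-- Multiplication by a bounded function, on `L²`. -/
def lpMulOp (m : 𝔼 → ℂ) (hm : MemLp m ∞ volume) :
    Lp ℂ 2 (volume : Measure 𝔼) →L[ℂ] Lp ℂ 2 (volume : Measure 𝔼) :=
  LinearMap.mkContinuous
    { toFun := fun f ↦ ((hm.toLp m • f : Lp ℂ 2 (volume : Measure 𝔼)))
      map_add' := fun f g ↦ Lp.add_smul _ f g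
      map_smul' := fun c f ↦ (Lp.smul_comm c _ f).symm }
    ‖hm.toLp m‖ fun f ↦ Lp.norm_smul_le _ f

/-- Multiplication by a bounded function. -/
def mulOp (m : 𝔼 → ℂ) (hm : MemLp m ∞ volume) : FreqSpace n →L[ℂ] FreqSpace n :=
  lpMulOp m hm

theorem fn_mulOp (m : 𝔼 → ℂ) (hm : MemLp m ∞ volume) (f : FreqSpace n) :
    (mulOp m hm f).fn =ᵐ[volume] fun ξ ↦ m ξ * f.fn ξ := by
  filter_upwards [Lp.coeFn_lpSMul (r := 2) (hm.toLp m)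
    f.toL2, hm.coeFn_toLp] with ξ h1 h2
  rw [← h2]
  exact h1

theorem toDist_mulOp {m : 𝔼 → ℂ} (hm : MemLp m ∞ volume) (hm' : m.HasTemperateGrowth)
    (f : FreqSpace n) :
    toDist (mulOp m hm f) = TemperedDistribution.smulLeftCLM ℂ m (toDist f) :=
  Lp.toTemperedDistribution_smul_eq hm' hm f.toL2

theorem mulOp_mulOp {m₁ m₂ m : 𝔼 → ℂ} (h₁ : MemLp m₁ ∞ volume) (h₂ : MemLp m₂ ∞ volume)
    (h : MemLp m ∞ volume) (hm : ∀ ξ, m₁ ξ * m₂ ξ = m ξ) (f : FreqSpace n) :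
    mulOp m₁ h₁ (mulOp m₂ h₂ f) = mulOp m h f := by
  refine ext_fn ?_
  filter_upwards [fn_mulOp m₁ h₁ (mulOp m₂ h₂ f), fn_mulOp m₂ h₂ f, fn_mulOp m h f] with ξ e1 e2 e3
  rw [e1, e2, e3, ← mul_assoc, hm]

theorem inner_eq (f g : FreqSpace n) : inner ℂ f g = ∫ ξ, inner ℂ (f.fn ξ) (g.fn ξ) :=
  L2.inner_def (𝕜 := ℂ) f.toL2 g.toL2

theorem inner_mulOp {m : 𝔼 → ℝ} (hm : MemLp (fun ξ ↦ (m ξ : ℂ)) ∞ volume) (f g : FreqSpace n) :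
    inner ℂ (mulOp _ hm f) g = inner ℂ f (mulOp _ hm g) := by
  rw [inner_eq, inner_eq]
  refine integral_congr_ae ?_
  filter_upwards [fn_mulOp _ hm f, fn_mulOp _ hm g] with ξ e1 e2
  rw [e1, e2]
  simp
  ring

theorem norm_mulOp_le {m : 𝔼 → ℂ} (hm : MemLp m ∞ volume) (h : ∀ ξ, ‖m ξ‖ ≤ 1)
    (f : FreqSpace n) : ‖mulOp m hm f‖ ≤ ‖f‖ := by
  refine Lp.norm_le_norm_of_ae_le (f := (mulOp m hm f).toL2)
    (g := f.toL2) ?_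
  filter_upwards [fn_mulOp m hm f] with ξ e1
  have : ‖(mulOp m hm f).fn ξ‖ ≤ ‖f.fn ξ‖ := by
    rw [e1, norm_mul]
    exact mul_le_of_le_one_left (norm_nonneg _) (h ξ)
  exact this

theorem norm_sq_eq (f : FreqSpace n) : ‖f‖ ^ 2 = ∫ ξ, ‖f.fn ξ‖ ^ 2 := by
  have h := inner_eq f f
  simp only [inner_self_eq_norm_sq_to_K] at h
  have h2 : ((‖f‖ ^ 2 : ℝ) : ℂ) = ((∫ ξ, ‖f.fn ξ‖ ^ 2 : ℝ) : ℂ) := by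
    rw [← integral_complex_ofReal]
    push_cast
    exact h
  exact_mod_cast h2

theorem integrable_norm_sq (f : FreqSpace n) : Integrable fun ξ ↦ ‖f.fn ξ‖ ^ 2 :=
  (memLp_two_iff_integrable_sq_norm (Lp.aestronglyMeasurable _)).1
    (Lp.memLp f.toL2)

/-- Dominated convergence for ∫|m_N - 1|²|f|², with majorant 4|f|². -/
theorem tendsto_mulOp {m : ℕ → 𝔼 → ℂ} (hm : ∀ N, MemLp (m N) ∞ volume)
    (h : ∀ N ξ, ‖m N ξ‖ ≤ 1) (hlim : ∀ ξ, Tendsto (fun N ↦ m N ξ) atTop (𝓝 1))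
    (f : FreqSpace n) : Tendsto (fun N ↦ mulOp (m N) (hm N) f) atTop (𝓝 f) := by
  have hfn : ∀ N, (mulOp (m N) (hm N) f - f).fn =ᵐ[volume] fun ξ ↦ (m N ξ - 1) * f.fn ξ := by
    intro N
    filter_upwards [fn_mulOp (m N) (hm N) f, Lp.coeFn_sub
      (mulOp (m N) (hm N) f).toL2
      f.toL2] with ξ e1 e2
    have e3 : (mulOp (m N) (hm N) f - f).fn ξ = (mulOp (m N) (hm N) f).fn ξ - f.fn ξ := e2
    rw [e3, e1]
    ring
  have key : Tendsto (fun N ↦ ‖mulOp (m N) (hm N) f - f‖ ^ 2) atTop (𝓝 0) := by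
    have h0 : (0 : ℝ) = ∫ ξ : 𝔼, (0 : ℝ) := by simp
    simp_rw [norm_sq_eq]
    rw [h0]
    refine tendsto_integral_of_dominated_convergence (fun ξ ↦ 4 * ‖f.fn ξ‖ ^ 2)
      (fun N ↦ (integrable_norm_sq _).aestronglyMeasurable) (f.integrable_norm_sq.const_mul 4)
      (fun N ↦ ?_) ?_
    · filter_upwards [hfn N] with ξ e1
      have h1 : ‖m N ξ - 1‖ ≤ 2 := (norm_sub_le _ _).trans (by
        rw [norm_one]
        linarith [h N ξ])
      rw [e1, norm_mul, norm_pow, norm_mul, norm_norm, norm_norm, mul_pow]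
      have : ‖m N ξ - 1‖ ^ 2 ≤ 2 ^ 2 := by gcongr
      nlinarith [sq_nonneg ‖f.fn ξ‖]
    · filter_upwards [ae_all_iff.2 hfn] with ξ e1
      simp_rw [e1]
      simpa using (((hlim ξ).sub_const 1).mul_const (f.fn ξ)).norm.pow 2
  rw [tendsto_iff_norm_sub_tendsto_zero]
  simpa using key.sqrt

/-! ### The Bessel weight -/

/-- The weight `⟨ξ⟩^r = (1 + |ξ|²)^(r/2)`. -/
def weight (r : ℝ) (ξ : 𝔼) : ℝ := (1 + ‖ξ‖ ^ 2) ^ (r / 2)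

theorem weight_pos (r : ℝ) (ξ : 𝔼) : 0 < weight r ξ := by
  unfold weight
  positivity

theorem weight_mul (r r' : ℝ) (ξ : 𝔼) : weight r ξ * weight r' ξ = weight (r + r') ξ := by
  simp only [weight]
  rw [← Real.rpow_add (by positivity), add_div]

theorem weight_two (ξ : 𝔼) : weight 2 ξ = 1 + ‖ξ‖ ^ 2 := by simp [weight]

theorem weight_zero (ξ : 𝔼) : weight 0 ξ = 1 := by simp [weight]

theorem weight_le_one {r : ℝ} (hr : r ≤ 0) (ξ : 𝔼) : weight r ξ ≤ 1 :=
  Real.rpow_le_one_of_one_le_of_nonpos (by simp) (by linarith)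

theorem continuous_weight (r : ℝ) : Continuous (weight (n := n) r) := by
  unfold weight
  exact Continuous.rpow_const (by fun_prop) fun ξ ↦ Or.inl (by positivity)

theorem hasTemperateGrowth_weight (r : ℝ) :
    Function.HasTemperateGrowth fun ξ : 𝔼 ↦ (weight r ξ : ℂ) := by
  unfold weight
  fun_prop

theorem smulLeftCLM_weight_weight (r r' : ℝ) (f : 𝓢'(𝔼, ℂ)) :
    TemperedDistribution.smulLeftCLM ℂ (fun ξ ↦ (weight r' ξ : ℂ))
      (TemperedDistribution.smulLeftCLM ℂ (fun ξ ↦ (weight r ξ : ℂ)) f) =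
      TemperedDistribution.smulLeftCLM ℂ (fun ξ ↦ (weight (r + r') ξ : ℂ)) f := by
  rw [TemperedDistribution.smulLeftCLM_smulLeftCLM_apply (hasTemperateGrowth_weight _)
    (hasTemperateGrowth_weight _)]
  have : ((fun ξ : 𝔼 ↦ (weight r ξ : ℂ)) * fun ξ : 𝔼 ↦ (weight r' ξ : ℂ)) =
      fun ξ ↦ (weight (r + r') ξ : ℂ) := by
    ext ξ
    rw [Pi.mul_apply, ← Complex.ofReal_mul, weight_mul]
  rw [this]

theorem memLp_top_of_abs_le {m : 𝔼 → ℝ} (hm : Measurable m) {C : ℝ} (hC : ∀ ξ, |m ξ| ≤ C) :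
    MemLp (fun ξ ↦ (m ξ : ℂ)) ∞ volume :=
  memLp_top_of_bound (by fun_prop) C (.of_forall fun ξ ↦ by simpa using hC ξ)

/-- The cutoff of the weight to a ball. -/
def cutWeight (r : ℝ) (N : ℕ) : 𝔼 → ℝ := (Metric.closedBall (0 : 𝔼) N).indicator (weight r)

theorem measurable_cutWeight (r : ℝ) (N : ℕ) : Measurable (cutWeight (n := n) r N) :=
  (continuous_weight r).measurable.indicator Metric.isClosed_closedBall.measurableSet

theorem exists_abs_cutWeight_le (r : ℝ) (N : ℕ) : ∃ C, ∀ ξ : 𝔼, |cutWeight r N ξ| ≤ C := by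
  obtain ⟨C, hC⟩ := (isCompact_closedBall (0 : 𝔼) N).exists_bound_of_continuousOn
    (continuous_weight r).continuousOn
  refine ⟨C, fun ξ ↦ ?_⟩
  by_cases h : ξ ∈ Metric.closedBall (0 : 𝔼) N
  · simpa [cutWeight, h] using hC ξ h
  · rw [cutWeight, indicator_of_notMem h, abs_zero]
    exact (norm_nonneg _).trans (hC 0 (by simp))

theorem memLp_cutWeight (r : ℝ) (N : ℕ) :
    MemLp (fun ξ : 𝔼 ↦ (cutWeight r N ξ : ℂ)) ∞ volume :=
  memLp_top_of_abs_le (measurable_cutWeight r N) (exists_abs_cutWeight_le r N).choose_spec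

theorem memLp_weight_neg_one : MemLp (fun ξ : 𝔼 ↦ (weight (-1) ξ : ℂ)) ∞ volume :=
  memLp_top_of_abs_le (continuous_weight _).measurable fun ξ ↦ by
    rw [abs_of_pos (weight_pos _ _)]
    exact weight_le_one (by norm_num) ξ

theorem cutWeight_mul_weight (r r' : ℝ) (N : ℕ) (ξ : 𝔼) :
    cutWeight r N ξ * weight r' ξ = cutWeight (r + r') N ξ := by
  by_cases h : ξ ∈ Metric.closedBall (0 : 𝔼) N <;> simp only [cutWeight, indicator_of_mem,
    indicator_of_notMem, h, not_false_eq_true, zero_mul, weight_mul]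

theorem cutWeight_mul_cutWeight (r r' : ℝ) (N : ℕ) (ξ : 𝔼) :
    cutWeight r N ξ * cutWeight r' N ξ = cutWeight (r + r') N ξ := by
  by_cases h : ξ ∈ Metric.closedBall (0 : 𝔼) N <;> simp only [cutWeight, indicator_of_mem,
    indicator_of_notMem, h, not_false_eq_true, zero_mul, weight_mul]

variable (n) in
/-- The operator `⟨ξ⟩⁻¹`. -/
def invWeight : FreqSpace n →L[ℝ] FreqSpace n :=
  (mulOp _ memLp_weight_neg_one).restrictScalars ℝ

variable (n) in
/-- The operator `⟨ξ⟩^r`, truncated to a ball. -/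
def cutOp (r : ℝ) (N : ℕ) : FreqSpace n →L[ℝ] FreqSpace n :=
  (mulOp _ (memLp_cutWeight r N)).restrictScalars ℝ

/-- All three are multiplications by real functions, so the algebra is addition of exponents of ⟨ξ⟩
and symmetry is automatic; the balls exhaust frequency space. -/
theorem isCutoff : IsCutoff (H := FreqSpace n) (invWeight n) (cutOp n 1) (cutOp n 0) where
  apply_J N x := mulOp_mulOp _ _ _ (fun ξ ↦ by
    rw [← Complex.ofReal_mul, cutWeight_mul_weight]; norm_num) x
  J_apply N x := mulOp_mulOp _ _ _ (fun ξ ↦ by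
    rw [mul_comm, ← Complex.ofReal_mul, cutWeight_mul_weight]; norm_num) x
  proj_apply N x := mulOp_mulOp _ _ _ (fun ξ ↦ by
    rw [← Complex.ofReal_mul, cutWeight_mul_cutWeight]; norm_num) x
  symm N x y := congrArg Complex.re (inner_mulOp (memLp_cutWeight 1 N) x y)
  symm_J x y := congrArg Complex.re (inner_mulOp memLp_weight_neg_one x y)
  norm_J_le x := norm_mulOp_le _ (fun ξ ↦ by
    rw [Complex.norm_real, Real.norm_eq_abs, abs_of_pos (weight_pos _ _)]
    exact weight_le_one (by norm_num) ξ) x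
  norm_proj_le N x := norm_mulOp_le _ (fun ξ ↦ by
    by_cases h : ξ ∈ Metric.closedBall (0 : 𝔼) N <;> simp [cutWeight, h, weight_zero]) x
  tendsto_proj x := tendsto_mulOp (fun N ↦ memLp_cutWeight 0 N) (fun N ξ ↦ by
    by_cases h : ξ ∈ Metric.closedBall (0 : 𝔼) N <;> simp [cutWeight, h, weight_zero])
    (fun ξ ↦ by
      refine tendsto_const_nhds.congr' ?_
      filter_upwards [eventually_ge_atTop ⌈‖ξ‖⌉₊] with N hN
      have h : ξ ∈ Metric.closedBall (0 : 𝔼) N := by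
        simpa using Nat.ceil_le.1 hN
      simp [cutWeight, h, weight_zero]) x

end FreqSpace

/-! ### The Fourier transform of Sobolev functions -/

namespace Sobolev

open FreqSpace

variable {n : ℕ} {s : ℝ}

local notation "𝔼" => EuclideanSpace ℝ (Fin n)

theorem bessel_surjective : Function.Surjective (bessel (n := n) (s := s)) := by
  intro g
  have h : TemperedDistribution.besselPotential 𝔼 ℂ s
      (TemperedDistribution.besselPotential 𝔼 ℂ (-s) (g : 𝓢'(𝔼, ℂ))) = g := by simp
  have hm : TemperedDistribution.MemSobolev s 2
      (TemperedDistribution.besselPotential 𝔼 ℂ (-s) (g : 𝓢'(𝔼, ℂ))) := ⟨g, h⟩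
  refine ⟨mk _ hm, lp_ext ?_⟩
  rw [← bessel_spec, toDist_mk, h]

/-- The isometry `f ↦ ⟨ξ⟩^s 𝓕 f` of `H^s` onto `L²`. -/
def freq : Sobolev n s ≃ₗᵢ[ℂ] FreqSpace n :=
  LinearIsometryEquiv.trans
    { LinearEquiv.ofBijective bessel ⟨bessel_injective, bessel_surjective⟩ with
      norm_map' := fun _ ↦ rfl }
    (Lp.fourierTransformₗᵢ 𝔼 ℂ)

theorem toDist_freq (f : Sobolev n s) : FreqSpace.toDist (freq f) =
    TemperedDistribution.smulLeftCLM ℂ (fun ξ ↦ (weight s ξ : ℂ)) (𝓕 (toDist f)) := by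
  have h1 : FreqSpace.toDist (freq f) = 𝓕 (bessel f : 𝓢'(𝔼, ℂ)) :=
    (Lp.fourier_toTemperedDistribution_eq (bessel f)).symm
  rw [h1, ← bessel_spec]
  exact TemperedDistribution.fourier_besselPotential_eq_smulLeftCLM_fourier_apply s _

theorem fourier_toDist (f : Sobolev n s) : 𝓕 (toDist f) =
    TemperedDistribution.smulLeftCLM ℂ (fun ξ ↦ (weight (-s) ξ : ℂ))
      (FreqSpace.toDist (freq f)) := by
  rw [toDist_freq, smulLeftCLM_weight_weight, add_neg_cancel]
  simp [weight_zero]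

theorem toDist_lower (k : ℕ) (f : Sobolev n s) : toDist (f.lower k) = toDist f :=
  toDist_mk _ _

theorem toDist_invWeight (g : FreqSpace n) : FreqSpace.toDist (invWeight n g) =
    TemperedDistribution.smulLeftCLM ℂ (fun ξ ↦ (weight (-1) ξ : ℂ)) (FreqSpace.toDist g) :=
  toDist_mulOp memLp_weight_neg_one (hasTemperateGrowth_weight _) g

/-- Lowering the order by one costs one weight: the origin of J in the abstract system. -/
theorem freq_lower (f : Sobolev n s) : freq (f.lower 1) = invWeight n (freq f) := by
  apply FreqSpace.toDist_injective
  rw [toDist_invWeight, toDist_freq, toDist_freq, smulLeftCLM_weight_weight, toDist_lower,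
    sub_eq_add_neg, Nat.cast_one]

/-- The Schwartz function `⟨ξ⟩^(2-s) 𝓕⁻¹ φ`. -/
def testFreq (s : ℝ) (φ : 𝓢(𝔼, ℂ)) : 𝓢(𝔼, ℂ) :=
  SchwartzMap.smulLeftCLM ℂ (fun ξ ↦ (weight (2 - s) ξ : ℂ)) (𝓕⁻ φ)

/-- Ensures that the equation, tested on all φ, is tested on all Schwartz functions in frequency. -/
theorem testFreq_surjective (s : ℝ) : Function.Surjective (testFreq (n := n) s) := by
  intro χ
  refine ⟨𝓕 (SchwartzMap.smulLeftCLM ℂ (fun ξ ↦ (weight (s - 2) ξ : ℂ)) χ), ?_⟩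
  ext ξ
  simp only [testFreq, FourierTransform.fourierInv_fourier_eq,
    SchwartzMap.smulLeftCLM_apply_apply (hasTemperateGrowth_weight _), smul_eq_mul]
  rw [← mul_assoc, ← Complex.ofReal_mul, weight_mul]
  simp [weight_zero]

/-- Every term of the equation lies in H^(s-2); its weight ⟨ξ⟩^(s-2) is compensated by ⟨ξ⟩^(2-s) in
the test function. -/
theorem toDist_apply (f : Sobolev n (s - (1 : ℕ))) (φ : 𝓢(𝔼, ℂ)) :
    toDist f φ = FreqSpace.toDist (invWeight n (freq f)) (testFreq s φ) := by
  have h2 : toDist f φ = (𝓕 (toDist f)) (𝓕⁻ φ) := by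
    rw [TemperedDistribution.fourier_apply, FourierTransform.fourier_fourierInv_eq]
  rw [toDist_invWeight, h2, fourier_toDist]
  simp only [TemperedDistribution.smulLeftCLM_apply_apply]
  congr 1
  ext ξ
  simp only [testFreq, SchwartzMap.smulLeftCLM_apply_apply (hasTemperateGrowth_weight _),
    smul_eq_mul]
  rw [← mul_assoc, ← Complex.ofReal_mul, weight_mul]
  congr 3
  push_cast
  ring

theorem laplacian_toDist_apply (f : Sobolev n s) (φ : 𝓢(𝔼, ℂ)) :
    Δ (toDist f) φ = FreqSpace.toDist
      (-(2 * Real.pi) ^ 2 • (freq f - invWeight n (invWeight n (freq f)))) (testFreq s φ) := by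
  rw [TemperedDistribution.laplacian_eq_fourierMultiplierCLM,
    TemperedDistribution.fourierMultiplierCLM_apply, fourier_toDist, ContinuousLinearMap.map_smul_of_tower,
    map_sub, toDist_invWeight, toDist_invWeight]
  have hsmul : ∀ (c : ℝ) (A : 𝓢'(𝔼, ℂ)) (χ : 𝓢(𝔼, ℂ)), (c • A) χ = c • A χ := fun _ _ _ ↦ rfl
  have hsub : ∀ (A B : 𝓢'(𝔼, ℂ)) (χ : 𝓢(𝔼, ℂ)), (A - B) χ = A χ - B χ := fun _ _ _ ↦ rfl
  rw [hsmul, hsmul, hsub]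
  congr 1
  have hsq : Function.HasTemperateGrowth fun ξ : 𝔼 ↦ Complex.ofReal (‖ξ‖ ^ 2) := by fun_prop
  simp only [TemperedDistribution.fourierInv_apply, TemperedDistribution.smulLeftCLM_apply_apply]
  rw [← map_sub]
  congr 1
  ext ξ
  simp only [testFreq, SchwartzMap.smulLeftCLM_apply_apply (hasTemperateGrowth_weight _),
    SchwartzMap.smulLeftCLM_apply_apply hsq, smul_eq_mul, _root_.sub_apply]
  -- This is |ξ|² = ⟨ξ⟩² - 1, which turns the symbol of the Laplacian into 1 - J².
  have h1 : weight (-s) ξ * ‖ξ‖ ^ 2 =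
      weight (2 - s) ξ - weight (-1) ξ * (weight (-1) ξ * weight (2 - s) ξ) := by
    have h2 : ‖ξ‖ ^ 2 = weight 2 ξ - 1 := by rw [weight_two]; ring
    rw [h2, mul_sub, weight_mul, weight_mul, weight_mul]
    ring_nf
  simp only [← mul_assoc, ← Complex.ofReal_mul, ← sub_mul, ← Complex.ofReal_sub]
  rw [h1]
  simp only [mul_assoc]

end Sobolev

end DampedWave

end

/-! ### Equivalence of the wave equation and the system in frequency -/

noncomputable section

namespace DampedWave

open FreqSpace Sobolev

variable {n : ℕ} {s : ℝ}

local notation "𝔼" => EuclideanSpace ℝ (Fin n)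

namespace FreqSpace

/-- The pairing of an element of `L²` with a Schwartz function. -/
def pair (χ : 𝓢(𝔼, ℂ)) : FreqSpace n →L[ℝ] ℂ :=
  ((PointwiseConvergenceCLM.evalCLM (RingHom.id ℂ) ℂ χ).comp toDist).restrictScalars ℝ

theorem ext_pair {f g : FreqSpace n} (h : ∀ χ : 𝓢(𝔼, ℂ), pair χ f = pair χ g) : f = g :=
  toDist_injective (by ext χ; exact h χ)

/-- A weakly differentiable function with a continuous derivative is differentiable. -/
theorem hasDerivWithinAt_of_pair {f g : ℝ → FreqSpace n} {T : ℝ} (hT : 0 ≤ T)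
    (hg : ContinuousOn g (Icc 0 T))
    (h : ∀ χ : 𝓢(𝔼, ℂ), ∀ t ∈ Icc 0 T,
      HasDerivWithinAt (fun τ ↦ pair χ (f τ)) (pair χ (g t)) (Icc 0 T) t)
    {t : ℝ} (ht : t ∈ Icc 0 T) : HasDerivWithinAt f (g t) (Icc 0 T) t := by
  -- Pairings with Schwartz functions separate points, so f = f(0) + ∫ g holds in L².
  refine ((hasDerivWithinAt_integral_Icc hT hg ht).const_add (f 0)).congr_of_mem
    (fun t ht ↦ ext_pair fun χ ↦ ?_) ht
  rw [eq_add_integral_of_hasDerivWithinAt hT ((pair χ).continuous.comp_continuousOn hg) (h χ) ht,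
    map_add, ← ContinuousLinearMap.intervalIntegral_comp_comm]
  · rfl
  · exact (hg.mono (by rw [uIcc_of_le ht.1]; exact Icc_subset_Icc_right ht.2)).intervalIntegrable

end FreqSpace

namespace Sobolev

/-- The isometry `freq`, as a real linear map. -/
def freqCLM : Sobolev n s →L[ℝ] FreqSpace n :=
  (freq.toContinuousLinearEquiv.toContinuousLinearMap).restrictScalars ℝ

/-- The inverse of the isometry `freq`, as a real linear map. -/
def freqSymmCLM : FreqSpace n →L[ℝ] Sobolev n s :=
  (freq.symm.toContinuousLinearEquiv.toContinuousLinearMap).restrictScalars ℝ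

theorem freqCLM_apply (f : Sobolev n s) : freqCLM f = freq f := rfl

end Sobolev

theorem pair_testFreq (a : ℝ) (f : Sobolev n s) (g : Sobolev n (s - (1 : ℕ))) (φ : 𝓢(𝔼, ℂ)) :
    pair (testFreq s φ) (-(2 * Real.pi) ^ 2 • (freq f - invWeight n (invWeight n (freq f))) -
      a • invWeight n (freq g) + invWeight n 0) = Δ (toDist f) φ - a * toDist g φ := by
  rw [Sobolev.toDist_apply, laplacian_toDist_apply, map_zero, add_zero, map_sub,
    map_smul _ a, Complex.real_smul]
  rfl

theorem timeDeriv_one (I : Set ℝ) (u : ℝ → Sobolev n s) (t : ℝ) :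
    timeDeriv 1 I u t = derivWithin (fun τ ↦ (u τ).lower 1) I t :=
  congrFun iteratedDerivWithin_one t

namespace IsSolution

variable {a : ℝ → ℝ} {I : Set ℝ} {u₀ : Sobolev n s} {u₁ : Sobolev n (s - 1)}
  {u : ℝ → Sobolev n s}

theorem hasDerivWithinAt_lower (h : IsSolution a I u₀ u₁ u) {t : ℝ} (ht : t ∈ I) :
    HasDerivWithinAt (fun τ ↦ (u τ).lower 1) (timeDeriv 1 I u t) I t := by
  rw [timeDeriv_one]
  exact ((h.isC1.differentiableOn (by simp)) t ht).hasDerivWithinAt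

theorem continuousOn_timeDeriv (h : IsSolution a I u₀ u₁ u) (hI : UniqueDiffOn ℝ I) :
    ContinuousOn (timeDeriv 1 I u) I :=
  (h.isC1.continuousOn_derivWithin hI (by simp)).congr fun t _ ↦ timeDeriv_one I u t

theorem timeDeriv_mono (h : IsSolution a I u₀ u₁ u) {I' : Set ℝ} (hI' : UniqueDiffOn ℝ I')
    (hsub : I' ⊆ I) {t : ℝ} (ht : t ∈ I') : timeDeriv 1 I' u t = timeDeriv 1 I u t := by
  rw [timeDeriv_one]
  exact ((h.hasDerivWithinAt_lower (hsub ht)).mono hsub).derivWithin (hI' t ht)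

theorem mono (h : IsSolution a I u₀ u₁ u) {I' : Set ℝ} (hI' : UniqueDiffOn ℝ I')
    (hsub : I' ⊆ I) (h0 : (0 : ℝ) ∈ I') : IsSolution a I' u₀ u₁ u where
  continuousOn := h.continuousOn.mono hsub
  isC1 := ContDiffOn.mono h.isC1 hsub
  equation φ t ht := by
    rw [h.timeDeriv_mono hI' hsub ht]
    exact ((h.equation φ t (hsub ht)).mono hsub).congr_of_mem
      (fun τ hτ ↦ by rw [h.timeDeriv_mono hI' hsub hτ]) ht
  initial := h.initial
  initial_deriv := by rw [h.timeDeriv_mono hI' hsub h0, h.initial_deriv]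

/-- The Fourier transform of a solution. -/
theorem isDampedSystem {T : ℝ} (hT : 0 < T) (h : IsSolution a (Icc 0 T) u₀ u₁ u)
    (ha : ContinuousOn a (Icc 0 T)) :
    IsDampedSystem (2 * Real.pi) (invWeight n) a 0 (Icc 0 T) (fun t ↦ freq (u t))
      (fun t ↦ freq (timeDeriv 1 (Icc 0 T) u t)) := by
  have hU : ContinuousOn (fun t ↦ freq (u t)) (Icc 0 T) :=
    freqCLM.continuous.comp_continuousOn h.continuousOn
  have hV : ContinuousOn (fun t ↦ freq (timeDeriv 1 (Icc 0 T) u t)) (Icc 0 T) :=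
    freqCLM.continuous.comp_continuousOn (h.continuousOn_timeDeriv (uniqueDiffOn_Icc hT))
  refine ⟨hU, hV, fun t ht ↦ ?_, fun t ht ↦ ?_⟩
  · have := freqCLM.hasFDerivAt.comp_hasDerivWithinAt t (h.hasDerivWithinAt_lower ht)
    simpa only [Function.comp_def, freqCLM_apply, freq_lower] using this
  · refine hasDerivWithinAt_of_pair (g := fun t ↦ -(2 * Real.pi) ^ 2 •
      (freq (u t) - invWeight n (invWeight n (freq (u t)))) -
        a t • invWeight n (freq (timeDeriv 1 (Icc 0 T) u t)) +
        invWeight n ((0 : ℝ → FreqSpace n) t)) hT.le ?_ (fun χ t ht ↦ ?_) ht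
    · simp only [Pi.zero_apply]
      fun_prop
    · obtain ⟨φ, rfl⟩ := testFreq_surjective s χ
      have := h.equation φ t ht
      refine (this.congr_of_mem (fun τ _ ↦ ?_) ht).congr_deriv (pair_testFreq _ _ _ _).symm
      exact (Sobolev.toDist_apply _ _).symm

end IsSolution

/-- Solutions of the equation, from their Fourier transforms. -/
theorem _root_.IsDampedSystem.isSolution {a : ℝ → ℝ} {I : Set ℝ} (hI : UniqueDiffOn ℝ I)
    (h0 : (0 : ℝ) ∈ I) {U V : ℝ → FreqSpace n}
    (h : IsDampedSystem (2 * Real.pi) (invWeight n) a 0 I U V) {u₀ : Sobolev n s}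
    {u₁ : Sobolev n (s - 1)} (hU : U 0 = freq u₀)
    (hV : toDist (freq.symm (V 0) : Sobolev n (s - (1 : ℕ))) = toDist u₁) :
    IsSolution a I u₀ u₁ (fun t ↦ freq.symm (U t)) := by
  have hlow : ∀ t, (freq.symm (U t) : Sobolev n s).lower 1 = freq.symm (invWeight n (U t)) :=
    fun t ↦ by
      apply freq.injective
      rw [freq_lower, LinearIsometryEquiv.apply_symm_apply, LinearIsometryEquiv.apply_symm_apply]
  have hd : ∀ t ∈ I, HasDerivWithinAt (fun τ ↦ (freq.symm (U τ) : Sobolev n s).lower 1)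
      (freq.symm (V t)) I t := fun t ht ↦ by
    simp only [hlow]
    exact freqSymmCLM.hasFDerivAt.comp_hasDerivWithinAt t (h.deriv_fst t ht)
  have hdw : ∀ t ∈ I, derivWithin (fun τ ↦ (freq.symm (U τ) : Sobolev n s).lower 1) I t =
      freq.symm (V t) := fun t ht ↦ (hd t ht).derivWithin (hI t ht)
  have htd : ∀ t ∈ I, timeDeriv 1 I (fun τ ↦ (freq.symm (U τ) : Sobolev n s)) t =
      freq.symm (V t) := fun t ht ↦ by rw [timeDeriv_one, hdw t ht]
  refine ⟨freqSymmCLM.continuous.comp_continuousOn h.1, ?_, fun φ t ht ↦ ?_, ?_, ?_⟩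
  · have : ContinuousOn (fun t ↦ (freq.symm (V t) : Sobolev n (s - (1 : ℕ)))) I :=
      freqSymmCLM.continuous.comp_continuousOn h.2
    exact ((contDiffOn_one_iff_derivWithin hI).2
      ⟨fun t ht ↦ (hd t ht).differentiableWithinAt, this.congr hdw⟩).of_le (by simp)
  · have h1 := (pair (testFreq s φ)).hasFDerivAt.comp_hasDerivWithinAt t (h.deriv_snd t ht)
    rw [htd t ht]
    refine (h1.congr_of_mem (fun τ hτ ↦ ?_) ht).congr_deriv ?_
    · rw [htd τ hτ, Sobolev.toDist_apply, LinearIsometryEquiv.apply_symm_apply]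
      rfl
    · rw [← pair_testFreq, LinearIsometryEquiv.apply_symm_apply,
        LinearIsometryEquiv.apply_symm_apply]
      rfl
  · rw [hU, LinearIsometryEquiv.symm_apply_apply]
  · rw [htd 0 h0, hV]

end DampedWave

end

/-! ### Regularisation of the coefficient -/

noncomputable section

namespace DampedWave

/-- A continuous probability density that is supported in `[-r, r]`. -/
structure IsKernel (φ : ℝ → ℝ) (r : ℝ) : Prop where
  continuous : Continuous φ
  compact : HasCompactSupport φ
  nonneg : ∀ τ, 0 ≤ φ τ
  integral_eq : ∫ τ, φ τ = 1
  abs_le : ∀ τ, φ τ ≠ 0 → |τ| ≤ r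

namespace IsKernel

variable {φ : ℝ → ℝ} {r : ℝ}

theorem integrable_mul (h : IsKernel φ r) {g : ℝ → ℝ} (hg : Continuous g) :
    Integrable fun τ ↦ φ τ * g τ :=
  (h.continuous.mul hg).integrable_of_hasCompactSupport h.compact.mul_right

theorem abs_integral_mul_le (h : IsKernel φ r) {g : ℝ → ℝ} {δ : ℝ}
    (hδ : ∀ τ, |τ| ≤ r → |g τ| ≤ δ) : |∫ τ, φ τ * g τ| ≤ δ := by
  have hi : Integrable φ := h.continuous.integrable_of_hasCompactSupport h.compact
  have := norm_integral_le_of_norm_le (hi.mul_const δ) (f := fun τ ↦ φ τ * g τ) (.of_forall ?_)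
  · rwa [integral_mul_const, h.integral_eq, one_mul] at this
  · intro τ
    by_cases h0 : φ τ = 0
    · simp [h0]
    · rw [norm_mul, Real.norm_eq_abs, Real.norm_eq_abs, abs_of_nonneg (h.nonneg τ)]
      have := hδ τ (h.abs_le τ h0)
      have := h.nonneg τ
      gcongr

theorem convolution_eq (B : ℝ → ℝ) (φ : ℝ → ℝ) (t : ℝ) :
    (B ⋆[ContinuousLinearMap.mul ℝ ℝ, volume] φ) t = ∫ τ, φ τ * B (t - τ) := by
  rw [convolution_eq_swap]
  simp [mul_comm]

/-- The left side is an average of the increments B(t - τ) - B(t) over |τ| ≤ r. -/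
theorem abs_convolution_sub_le (h : IsKernel φ r) {B : ℝ → ℝ} (hB : Continuous B) {t δ : ℝ}
    (hδ : ∀ τ, |τ| ≤ r → |B (t - τ) - B t| ≤ δ) :
    |(B ⋆[ContinuousLinearMap.mul ℝ ℝ, volume] φ) t - B t| ≤ δ := by
  have h1 : (B ⋆[ContinuousLinearMap.mul ℝ ℝ, volume] φ) t - B t =
      ∫ τ, φ τ * (B (t - τ) - B t) := by
    simp only [mul_sub]
    rw [integral_sub (h.integrable_mul (by fun_prop)) (h.integrable_mul (by fun_prop)),
      integral_mul_const, h.integral_eq, one_mul, convolution_eq]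
  rw [h1]
  exact h.abs_integral_mul_le hδ

/-- If `B` is close to a linear function near `t`, in the sense of Lipschitz functions, then so
are its regularisations. -/
theorem abs_deriv_convolution_sub_le (h : IsKernel φ r) {B : ℝ → ℝ} (hB : Continuous B)
    {t δ η c : ℝ} (hη : 0 < η) (hr : r ≤ η) (hδ : 0 ≤ δ)
    (hBc : ∀ x y, |x - t| ≤ 2 * η → |y - t| ≤ 2 * η → |B x - B y - c * (x - y)| ≤ δ * |x - y|)
    (hd : DifferentiableAt ℝ (B ⋆[ContinuousLinearMap.mul ℝ ℝ, volume] φ) t) :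
    |deriv (B ⋆[ContinuousLinearMap.mul ℝ ℝ, volume] φ) t - c| ≤ δ := by
  set β := B ⋆[ContinuousLinearMap.mul ℝ ℝ, volume] φ with hβ
  have h1 : HasDerivAt (fun x ↦ β x - c * x) (deriv β t - c) t := by
    simpa using hd.hasDerivAt.fun_sub ((hasDerivAt_id t).const_mul c)
  refine h1.le_of_lip' hδ ?_
  filter_upwards [Metric.closedBall_mem_nhds t hη] with x hx
  rw [Metric.mem_closedBall, Real.dist_eq] at hx
  have h2 : β x - c * x - (β t - c * t) =
      ∫ τ, φ τ * (B (x - τ) - B (t - τ) - c * (x - t)) := by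
    simp only [mul_sub]
    have i1 := h.integrable_mul (g := fun τ ↦ B (x - τ)) (by fun_prop)
    have i2 := h.integrable_mul (g := fun τ ↦ B (t - τ)) (by fun_prop)
    have i3 := h.integrable_mul (g := fun τ ↦ c * x) (by fun_prop)
    have i4 := h.integrable_mul (g := fun τ ↦ c * t) (by fun_prop)
    have i12 : Integrable fun τ ↦ φ τ * B (x - τ) - φ τ * B (t - τ) := i1.sub i2
    have i34 : Integrable fun τ ↦ φ τ * (c * x) - φ τ * (c * t) := i3.sub i4
    rw [integral_sub i12 i34, integral_sub i1 i2, integral_sub i3 i4,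
      integral_mul_const, integral_mul_const, h.integral_eq, hβ, convolution_eq, convolution_eq]
    ring
  rw [h2, Real.norm_eq_abs, Real.norm_eq_abs]
  refine h.abs_integral_mul_le fun τ hτ ↦ ?_
  -- Both points stay within 2η of t, since |x - t| and |τ| are at most η, and their difference is
  -- still x - t.
  have h3 := hBc (x - τ) (t - τ) (by
    have := abs_sub (x - t) τ
    rw [show x - τ - t = x - t - τ by ring]
    linarith) (by
    rw [show t - τ - t = -τ by ring, abs_neg]
    linarith)
  rwa [show x - τ - (t - τ) = x - t by ring] at h3

end IsKernel

/-- The rescalings of a mollifier. -/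
theorem IsMollifier.exists_isKernel {ψ : ℝ → ℝ} (h : IsMollifier ψ) :
    ∃ R : ℝ, ∀ ρ : ℝ, 0 < ρ → IsKernel (fun t ↦ ρ⁻¹ * ψ (t / ρ)) (R * ρ) := by
  obtain ⟨R, hR⟩ := h.compact.isCompact.isBounded.exists_norm_le
  refine ⟨R, fun ρ hρ ↦ ⟨?_, ?_, ?_, ?_, ?_⟩⟩
  · have := h.smooth.continuous
    fun_prop
  · have := h.compact.comp_homeomorph (Homeomorph.mulRight₀ ρ⁻¹ (inv_ne_zero hρ.ne'))
    exact HasCompactSupport.mul_left (by simpa [Function.comp_def, div_eq_mul_inv] using this)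
  · intro τ
    have := h.nonneg (τ / ρ)
    positivity
  · rw [integral_const_mul, Measure.integral_comp_div, h.integral_eq, abs_of_pos hρ, smul_eq_mul,
      mul_one, inv_mul_cancel₀ hρ.ne']
  · intro τ hτ
    have h1 : ψ (τ / ρ) ≠ 0 := right_ne_zero_of_mul hτ
    have h2 := hR (τ / ρ) (subset_tsupport _ h1)
    rwa [Real.norm_eq_abs, abs_div, abs_of_pos hρ, div_le_iff₀ hρ] at h2

theorem continuousOn_dissipation {b : ℝ → ℝ} (hb : ContDiffOn ℝ 1 b (Ici 0))
    (hpos : ∀ t ∈ Ici (0 : ℝ), 0 < b t) : ContinuousOn (dissipation b) (Ici 0) :=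
  (hb.continuousOn_derivWithin (uniqueDiffOn_Ici 0) le_rfl).div hb.continuousOn
    fun t ht ↦ (hpos t ht).ne'

namespace IsRegularisingFamily

variable {b : ℝ → ℝ} {bε : ℝ → ℝ → ℝ}

/-- The regularisations and their derivatives converge, boundedly. -/
theorem convergence (h : IsRegularisingFamily b bε) (hb : ContDiffOn ℝ 1 b (Ici 0)) {T : ℝ}
    (hT : 0 ≤ T) :
    (∃ m > 0, ∀ᶠ ε in 𝓝[>] 0, ∀ t ∈ Icc 0 T, m ≤ bε ε t) ∧
    (∃ L, ∀ᶠ ε in 𝓝[>] 0, ∀ t ∈ Icc 0 T, |deriv (bε ε) t| ≤ L) ∧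
    (∀ t ∈ Icc 0 T, Tendsto (fun ε ↦ bε ε t) (𝓝[>] 0) (𝓝 (b t))) ∧
    (∀ t, 0 < t → Tendsto (fun ε ↦ deriv (bε ε) t) (𝓝[>] 0) (𝓝 (derivWithin b (Ici 0) t))) := by
  obtain ⟨⟨hsm, -⟩, ψ, ρ, B, hψ, hρ, hρ0, hBb, hBpos, hBL, hconv⟩ := h
  have hBc : Continuous B := hBL.continuous
  obtain ⟨R, hR⟩ := hψ.exists_isKernel
  have hIoc : ∀ᶠ ε : ℝ in 𝓝[>] 0, ε ∈ Ioc (0 : ℝ) 1 := Ioc_mem_nhdsGT one_pos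
  have hr : ∀ η > 0, ∀ᶠ ε in 𝓝[>] 0, R * ρ ε ≤ η := fun η hη ↦ by
    have : Tendsto (fun ε ↦ R * ρ ε) (𝓝[>] 0) (𝓝 0) := by simpa using hρ0.const_mul R
    exact (this.eventually (gt_mem_nhds hη)).mono fun _ h ↦ h.le
  have hker : ∀ ε ∈ Ioc (0 : ℝ) 1, IsKernel (fun t ↦ (ρ ε)⁻¹ * ψ (t / ρ ε)) (R * ρ ε) :=
    fun ε hε ↦ hR _ (hρ ε hε)
  -- The margin 2 is 2η for η = 1 in `abs_deriv_convolution_sub_le`.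
  obtain ⟨L, hL⟩ := (hBL.locallyLipschitzOn (s := Icc (-2) (T + 2))).exists_lipschitzOnWith_of_compact
    isCompact_Icc
  have hLip : ∀ x ∈ Icc (-2) (T + 2), ∀ y ∈ Icc (-2) (T + 2), |B x - B y| ≤ L * |x - y| :=
    fun x hx y hy ↦ by simpa [Real.dist_eq] using hL.dist_le_mul x hx y hy
  have hclose : ∀ ε ∈ Ioc (0 : ℝ) 1, R * ρ ε ≤ 1 → ∀ t ∈ Icc 0 T,
      |bε ε t - B t| ≤ L * (R * ρ ε) := fun ε hε hr1 t ht ↦ by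
    rw [hconv ε hε]
    refine (hker ε hε).abs_convolution_sub_le hBc fun τ hτ ↦ ?_
    have h1 := abs_le.1 (hτ.trans hr1)
    refine (hLip _ ⟨by linarith [ht.1], by linarith [ht.2]⟩ _
      ⟨by linarith [ht.1], by linarith [ht.2]⟩).trans ?_
    rw [show t - τ - t = -τ by ring, abs_neg]
    gcongr
  have hdiff : ∀ ε ∈ Ioc (0 : ℝ) 1, ∀ t, DifferentiableAt ℝ (bε ε) t := fun ε hε t ↦
    ((hsm ε hε).differentiable (by simp)) t
  have hlim0 : Tendsto (fun ε ↦ L * (R * ρ ε)) (𝓝[>] 0) (𝓝 0) := by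
    simpa using (hρ0.const_mul R).const_mul (L : ℝ)
  refine ⟨?_, ⟨L, ?_⟩, ?_, ?_⟩
  · obtain ⟨t₀, -, ht₀⟩ := isCompact_Icc.exists_isMinOn (nonempty_Icc.2 hT) hBc.continuousOn
    refine ⟨B t₀ / 2, half_pos (hBpos _), ?_⟩
    filter_upwards [hIoc, hr 1 one_pos, hlim0.eventually (gt_mem_nhds (half_pos (hBpos t₀)))]
      with ε hε hr1 hlt t ht
    have h1 := abs_le.1 (hclose ε hε hr1 t ht)
    have h2 : B t₀ ≤ B t := ht₀ ht
    linarith [h1.1]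
  · filter_upwards [hIoc, hr 1 one_pos] with ε hε hr1 t ht
    -- With slope c = 0 the comparison bounds the derivative by the Lipschitz constant.
    have h1 := (hker ε hε).abs_deriv_convolution_sub_le hBc (t := t) (δ := L) (c := 0) one_pos hr1
      L.2 (fun x y hx hy ↦ by
        have := abs_le.1 hx
        have := abs_le.1 hy
        rw [zero_mul, sub_zero]
        exact hLip x ⟨by linarith [ht.1], by linarith [ht.2]⟩ y
          ⟨by linarith [ht.1], by linarith [ht.2]⟩) (by
        rw [← hconv ε hε]
        exact hdiff ε hε t)
    rwa [← hconv ε hε, sub_zero] at h1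
  · intro t ht
    rw [← hBb (mem_Ici.2 ht.1), tendsto_iff_dist_tendsto_zero]
    refine squeeze_zero' (.of_forall fun _ ↦ dist_nonneg) ?_ hlim0
    filter_upwards [hIoc, hr 1 one_pos] with ε hε hr1
    exact hclose ε hε hr1 t ht
  · intro t ht
    have hEq : B =ᶠ[𝓝 t] b := hBb.eventuallyEq_of_mem (Ici_mem_nhds ht)
    have hbt : ContDiffAt ℝ 1 b t := hb.contDiffAt (Ici_mem_nhds ht)
    -- The comparison needs increments between two arbitrary points near t, hence strict
    -- differentiability. It holds for t > 0, where B agrees with the C¹ function b nearby.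
    have hBt : HasStrictDerivAt B (derivWithin b (Ici 0) t) t := by
      have := (hbt.congr_of_eventuallyEq hEq).hasStrictDerivAt (by simp)
      rwa [hEq.deriv_eq, ← derivWithin_of_mem_nhds (Ici_mem_nhds ht)] at this
    set c := derivWithin b (Ici 0) t
    rw [Metric.tendsto_nhds]
    intro δ hδ
    have h1 := hBt.isLittleO.def (half_pos hδ)
    rw [nhds_prod_eq] at h1
    obtain ⟨η, hη, h2⟩ := Metric.nhds_basis_closedBall.prod_self.eventually_iff.1 h1
    have hη2 : 0 < η / 2 := half_pos hη
    filter_upwards [hIoc, hr _ hη2] with ε hε hr1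
    have h3 := (hker ε hε).abs_deriv_convolution_sub_le hBc (t := t) (δ := δ / 2) (c := c) hη2 hr1
      (half_pos hδ).le (fun x y hx hy ↦ by
        have h4 := @h2 (x, y) ⟨by rw [Metric.mem_closedBall, Real.dist_eq]; linarith,
          by rw [Metric.mem_closedBall, Real.dist_eq]; linarith⟩
        simpa [mul_comm] using h4) (by
        rw [← hconv ε hε]
        exact hdiff ε hε t)
    rw [← hconv ε hε] at h3
    rw [Real.dist_eq]
    linarith

theorem eventually_continuousOn (h : IsRegularisingFamily b bε) (hb : ContDiffOn ℝ 1 b (Ici 0))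
    {T : ℝ} (hT : 0 ≤ T) :
    ∀ᶠ ε in 𝓝[>] 0, ContinuousOn (fun t ↦ deriv (bε ε) t / bε ε t) (Icc 0 T) := by
  obtain ⟨⟨m, hm, h1⟩, -⟩ := h.convergence hb hT
  filter_upwards [h1, Ioc_mem_nhdsGT one_pos] with ε h1 hε
  exact ((h.1.1 ε hε).continuous_deriv (by simp)).continuousOn.div
    (h.1.1 ε hε).continuous.continuousOn fun t ht ↦ (hm.trans_le (h1 t ht)).ne'

theorem exists_eventually_abs_le (h : IsRegularisingFamily b bε) (hb : ContDiffOn ℝ 1 b (Ici 0))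
    {T : ℝ} (hT : 0 ≤ T) :
    ∃ α, ∀ᶠ ε in 𝓝[>] 0, ∀ t ∈ Icc 0 T, |deriv (bε ε) t / bε ε t| ≤ α := by
  obtain ⟨⟨m, hm, h1⟩, ⟨L, h2⟩, -⟩ := h.convergence hb hT
  refine ⟨L / m, ?_⟩
  filter_upwards [h1, h2] with ε h1 h2 t ht
  have h3 := h1 t ht
  have h4 := h2 t ht
  have hL : 0 ≤ L := (abs_nonneg _).trans h4
  rw [abs_div, abs_of_pos (hm.trans_le h3)]
  gcongr

/-- Dominated convergence; the possible kink of the extension at t = 0 is a null set. -/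
theorem tendsto_integral (h : IsRegularisingFamily b bε) (hb : ContDiffOn ℝ 1 b (Ici 0))
    (hpos : ∀ t ∈ Ici (0 : ℝ), 0 < b t) {T : ℝ} (hT : 0 ≤ T) :
    Tendsto (fun ε ↦ ∫ t in (0 : ℝ)..T, |dissipation b t - deriv (bε ε) t / bε ε t|) (𝓝[>] 0)
      (𝓝 0) := by
  obtain ⟨-, -, h3, h4⟩ := h.convergence hb hT
  obtain ⟨α, hα⟩ := h.exists_eventually_abs_le hb hT
  have hc := (continuousOn_dissipation hb hpos).mono (Icc_subset_Ici_self : Icc 0 T ⊆ Ici 0)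
  obtain ⟨β, hβ⟩ := isCompact_Icc.exists_bound_of_continuousOn hc
  have hsub : uIoc 0 T ⊆ Icc 0 T := by
    rw [uIoc_of_le hT]
    exact Ioc_subset_Icc_self
  suffices Tendsto (fun ε ↦ ∫ t in (0 : ℝ)..T, |dissipation b t - deriv (bε ε) t / bε ε t|)
      (𝓝[>] 0) (𝓝 (∫ _ in (0 : ℝ)..T, (0 : ℝ))) by simpa using this
  refine intervalIntegral.tendsto_integral_filter_of_dominated_convergence (fun _ ↦ β + α)
    ?_ ?_ (by simp) ?_
  · filter_upwards [h.eventually_continuousOn hb hT] with ε hε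
    exact ((hc.sub hε).abs.mono hsub).aestronglyMeasurable measurableSet_uIoc
  · filter_upwards [hα] with ε hε
    refine .of_forall fun t ht ↦ ?_
    rw [Real.norm_eq_abs, abs_abs]
    exact (abs_sub _ _).trans (add_le_add (hβ t (hsub ht)) (hε t (hsub ht)))
  · refine .of_forall fun t ht ↦ ?_
    have ht0 : 0 < t := by
      rw [uIoc_of_le hT] at ht
      exact ht.1
    have := (((h4 t ht0).div (h3 t (hsub ht)) (hpos t ht0.le).ne').const_sub
      (dissipation b t)).abs
    simpa [dissipation] using this

end IsRegularisingFamily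

end DampedWave

end

/-! ### Existence, uniqueness and consistency for the Cauchy problem -/

namespace DampedWave

variable {n : ℕ} {s : ℝ}

/-- Initial velocities, as elements of the space of the time derivatives. -/
theorem exists_toDist_eq (u₁ : Sobolev n (s - 1)) :
    ∃ f : Sobolev n (s - (1 : ℕ)), f.toDist = u₁.toDist :=
  ⟨Sobolev.mk u₁.toDist ((Sobolev.memSobolev u₁).mono (by simp)), Sobolev.toDist_mk _ _⟩

/-- Existence of solutions of the Cauchy problem. -/
theorem exists_isSolution {a : ℝ → ℝ} (ha : ContinuousOn a (Ici 0)) (u₀ : Sobolev n s)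
    (u₁ : Sobolev n (s - 1)) : ∃ u : ℝ → Sobolev n s, IsSolution a (Ici 0) u₀ u₁ u := by
  obtain ⟨f, hf⟩ := exists_toDist_eq u₁
  obtain ⟨U, V, hU, hV, h⟩ := IsDampedSystem.exists_solution Real.two_pi_pos FreqSpace.isCutoff ha
    (Sobolev.freq u₀) (Sobolev.freq f)
  exact ⟨_, h.isSolution (uniqueDiffOn_Ici 0) self_mem_Ici hU
    (by rw [hV, LinearIsometryEquiv.symm_apply_apply, hf])⟩

theorem IsSolution.freq_timeDeriv_zero {a a' : ℝ → ℝ} {I : Set ℝ} {u₀ : Sobolev n s}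
    {u₁ : Sobolev n (s - 1)} {u v : ℝ → Sobolev n s} (hu : IsSolution a I u₀ u₁ u)
    (hv : IsSolution a' I u₀ u₁ v) :
    Sobolev.freq (timeDeriv 1 I v 0) = Sobolev.freq (timeDeriv 1 I u 0) :=
  congrArg _ (Sobolev.toDist_injective (hv.initial_deriv.trans hu.initial_deriv.symm))

/-- Uniqueness of solutions of the Cauchy problem. -/
theorem IsSolution.eqOn {a : ℝ → ℝ} {T : ℝ} (hT : 0 < T) (ha : ContinuousOn a (Icc 0 T))
    {u₀ : Sobolev n s} {u₁ : Sobolev n (s - 1)} {u v : ℝ → Sobolev n s}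
    (hu : IsSolution a (Icc 0 T) u₀ u₁ u) (hv : IsSolution a (Icc 0 T) u₀ u₁ v) :
    EqOn v u (Icc 0 T) := fun t ht ↦
  Sobolev.freq.injective (IsDampedSystem.eqOn Real.two_pi_pos FreqSpace.isCutoff hT.le
    (hu.isDampedSystem hT ha) ha (hv.isDampedSystem hT ha)
    (by simp only [hu.initial, hv.initial]) (hu.freq_timeDeriv_zero hv) ht)

/-- `Sobolev.freq` is an isometry. -/
theorem tendstoUniformlyOn_of_freq {r : ℝ} {ι : Type*} {l : Filter ι} {I : Set ℝ}
    {F : ι → ℝ → Sobolev n r} {f : ℝ → Sobolev n r}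
    (h : TendstoUniformlyOn (fun i t ↦ Sobolev.freq (F i t)) (fun t ↦ Sobolev.freq (f t)) l I) :
    TendstoUniformlyOn F f l I := by
  rw [Metric.tendstoUniformlyOn_iff] at h ⊢
  simpa only [LinearIsometryEquiv.dist_map] using h

/-- Convergence of very weak solutions. -/
theorem IsVeryWeakSolution.tendstoUniformlyOn {b : ℝ → ℝ} (hb : ContDiffOn ℝ 1 b (Ici 0))
    (hpos : ∀ t ∈ Ici (0 : ℝ), 0 < b t) {bε : ℝ → ℝ → ℝ} {u₀ : Sobolev n s}
    {u₁ : Sobolev n (s - 1)} {u : ℝ → Sobolev n s} {uε : ℝ → ℝ → Sobolev n s} {T : ℝ} (hT : 0 < T)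
    (hu : IsSolution (dissipation b) (Icc 0 T) u₀ u₁ u)
    (h : IsVeryWeakSolution b bε u₀ u₁ uε) :
    TendstoUniformlyOn uε u (𝓝[>] 0) (Icc 0 T) ∧
      TendstoUniformlyOn (fun ε ↦ timeDeriv 1 (Icc 0 T) (uε ε)) (timeDeriv 1 (Icc 0 T) u)
        (𝓝[>] 0) (Icc 0 T) := by
  have ha : ContinuousOn (dissipation b) (Icc 0 T) :=
    (continuousOn_dissipation hb hpos).mono Icc_subset_Ici_self
  have hIoc : ∀ᶠ ε : ℝ in 𝓝[>] 0, ε ∈ Ioc (0 : ℝ) 1 := Ioc_mem_nhdsGT one_pos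
  have hsol : ∀ ε ∈ Ioc (0 : ℝ) 1, IsSolution (fun t ↦ deriv (bε ε) t / bε ε t) (Icc 0 T) u₀ u₁
      (uε ε) := fun ε hε ↦ (h.solves ε hε).mono (uniqueDiffOn_Icc hT) Icc_subset_Ici_self
    (left_mem_Icc.2 hT.le)
  have hcont := h.regularising.eventually_continuousOn hb hT.le
  obtain ⟨α, hα⟩ := h.regularising.exists_eventually_abs_le hb hT.le
  have key := IsDampedSystem.tendstoUniformlyOn Real.two_pi_pos FreqSpace.isCutoff hT.le
    (hu.isDampedSystem hT ha) ha (l := 𝓝[>] 0) (a' := fun ε t ↦ deriv (bε ε) t / bε ε t)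
    (U' := fun ε t ↦ Sobolev.freq (uε ε t))
    (V' := fun ε t ↦ Sobolev.freq (timeDeriv 1 (Icc 0 T) (uε ε) t))
    (by
      filter_upwards [hIoc, hcont] with ε hε hc
      exact (hsol ε hε).isDampedSystem hT hc)
    (by
      filter_upwards [hIoc] with ε hε
      simp only [hu.initial, (hsol ε hε).initial])
    (by
      filter_upwards [hIoc] with ε hε
      exact hu.freq_timeDeriv_zero (hsol ε hε))
    hcont hα (h.regularising.tendsto_integral hb hpos hT.le)
  exact ⟨tendstoUniformlyOn_of_freq key.1, tendstoUniformlyOn_of_freq key.2⟩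

end DampedWave

theorem mainTheorem3 (n : ℕ) (hn : 1 ≤ n) (s : ℝ) (hs : 0 < s)
    (b : ℝ → ℝ) (b₀ b₀' : ℝ) (hb₀ : 0 < b₀) (hb₀' : 0 < b₀')
    (hb : ContDiffOn ℝ 1 b (Ici 0)) (hmono : MonotoneOn b (Ici 0))
    (hb_ge : ∀ t ∈ Ici (0 : ℝ), b₀ ≤ b t)
    (hb'_ge : ∀ t ∈ Ici (0 : ℝ), b₀' ≤ derivWithin b (Ici 0) t)
    (u₀ : DampedWave.Sobolev n s) (u₁ : DampedWave.Sobolev n (s - 1)) :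
    ∃ u : ℝ → DampedWave.Sobolev n s,
      DampedWave.IsSolution (DampedWave.dissipation b) (Ici 0) u₀ u₁ u ∧
      ∀ T : ℝ, 0 < T →
        -- `u` is the unique classical solution on `[0, T]`
        DampedWave.IsSolution (DampedWave.dissipation b) (Icc 0 T) u₀ u₁ u ∧
        (∀ v : ℝ → DampedWave.Sobolev n s,
          DampedWave.IsSolution (DampedWave.dissipation b) (Icc 0 T) u₀ u₁ v →
            EqOn v u (Icc 0 T)) ∧
        -- every very weak solution converges to `u` in `C([0,T]; H^s) ∩ C¹([0,T]; H^{s-1})`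
        ∀ (bε : ℝ → ℝ → ℝ) (uε : ℝ → ℝ → DampedWave.Sobolev n s),
          DampedWave.IsVeryWeakSolution b bε u₀ u₁ uε →
            TendstoUniformlyOn uε u (𝓝[>] 0) (Icc 0 T) ∧
            TendstoUniformlyOn (fun ε ↦ DampedWave.timeDeriv 1 (Icc 0 T) (uε ε))
              (DampedWave.timeDeriv 1 (Icc 0 T) u) (𝓝[>] 0) (Icc 0 T) := by
  have hpos : ∀ t ∈ Ici (0 : ℝ), 0 < b t := fun t ht ↦ hb₀.trans_le (hb_ge t ht)
  have ha := DampedWave.continuousOn_dissipation hb hpos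
  obtain ⟨u, hu⟩ := DampedWave.exists_isSolution ha u₀ u₁
  refine ⟨u, hu, fun T hT ↦ ?_⟩
  have huT := hu.mono (uniqueDiffOn_Icc hT) Icc_subset_Ici_self (left_mem_Icc.2 hT.le)
  exact ⟨huT, fun v hv ↦ huT.eqOn hT (ha.mono Icc_subset_Ici_self) hv,
    fun bε uε h ↦ h.tendstoUniformlyOn hb hpos hT huT⟩
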